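/- Let $Y$ be a compact connected nonorientable Klein surface: a compact connected Hausdorff nonorientable surface without boundary, with an atlas of charts into $\mathbb C$ whose transition functions are, near each point, holomorphic or anti-holomorphic; a chart is compatible if it belongs to the maximal such atlas. Let $\pi\colon X\to Y$ be the double cover of $Y$ by local orientations, a Riemann surface, and let $\sigma\colon X\to X$ be the anti-holomorphic involution that changes the orientation. Let $\widehat{\mathbb C}=\mathbb C\cup\{\infty\}$, let $j(z)=\bar z$, $j(\infty)=\infty$, and let $p\colon\widehat{\mathbb C}\to\overline{\mathbb H}=\widehat{\mathbb C}/\langle j\rangle$ be the quotient map onto the closed upper half-plane. A divisor is a finite formal sum of points with integer coefficients; its degree is the sum of the coefficients. Put $\pi^*(\sum_k n_k y_k)=\sum_k n_k\,(x_k+\sigma(x_k))$ with $\pi(x_k)=y_k$, and $\sigma^*(\sum_k m_k x_k)=\sum_k m_k\,\sigma(x_k)$. A divisor on $X$ is principal if it is the divisor (zeros minus poles, with multiplicity) of a meromorphic function on $X$ that is not identically $0$, i.e. of a holomorphic map $X\to\widehat{\mathbb C}$ not identically $0$ or $\infty$. A morphism $u\colon Y\to\overline{\mathbb H}$ is a continuous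 map such that for each compatible chart $w\colon U\to\mathbb H$ (with values in the open upper half-plane) there is a holomorphic map $F\colon w(U)\to\widehat{\mathbb C}$ with $u=p\circ F\circ w$ on $U$. The multiplicity of $u$ at $y\in U$ is that of $F$ at $w(y)$. For $u$ not identically $0$ or $\infty$, $\operatorname{div}(u)=u^{-1}(0)-u^{-1}(\infty)$, counted with multiplicity. A divisor $D$ on $Y$ is principal if $D=\operatorname{div}(u)$ for such a morphism $u$. Then, for every divisor $D$ on $Y$: 1. $D$ is principal if and only if there is a principal divisor $E$ on $X$ with $\sigma^*E=E$ and $\pi^*D=E$; 2. $D$ is principal if and only if $\pi^*D$ is principal on $X$; 3. if $D$ is principal, then $\pi^*D=\operatorname{div}(f)$ for a meromorphic function $f\not\equiv0$ on $X$ with $f\circ\sigma=j\circ f$; 4. in particular, if $D$ has degree zero, then $D$ is principal on $Y$ if and only if $\pi^*D$ is principal on $X$. -/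

import Mathlib

noncomputable section

open Set Filter Topology Complex
open scoped Manifold ContDiff

set_option linter.unusedSectionVars false

namespace KleinSurface

/-! ## Klein surfaces -/

/-- `f` is holomorphic near `z`, or anti-holomorphic near `z` (its conjugate is holomorphic). -/
def DianalyticAt (f : ℂ → ℂ) (z : ℂ) : Prop :=
  AnalyticAt ℂ f z ∨ AnalyticAt ℂ (fun w => starRingEnd ℂ (f w)) z

theorem analyticAt_conj_conj {f : ℂ → ℂ} {z : ℂ} (h : AnalyticAt ℂ f z) :
    AnalyticAt ℂ (fun w => starRingEnd ℂ (f (starRingEnd ℂ w))) (starRingEnd ℂ z) := by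
  rw [Complex.analyticAt_iff_eventually_differentiableAt] at h ⊢
  have hc : Tendsto (starRingEnd ℂ) (𝓝 (starRingEnd ℂ z)) (𝓝 z) := by
    have := (Complex.continuous_conj.tendsto (starRingEnd ℂ z))
    rwa [Complex.conj_conj] at this
  filter_upwards [hc.eventually h] with w hw
  have := hw.conj_conj
  rwa [Complex.conj_conj] at this

theorem analyticAt_conj_comp {f g : ℂ → ℂ} {z : ℂ}
    (hg : AnalyticAt ℂ g (f z)) (hf : AnalyticAt ℂ (fun w => starRingEnd ℂ (f w)) z) :
    AnalyticAt ℂ (fun w => starRingEnd ℂ (g (f w))) z := by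
  have := (analyticAt_conj_conj hg).fun_comp_of_eq (f := fun w => starRingEnd ℂ (f w)) hf rfl
  simpa only [Complex.conj_conj] using this

theorem DianalyticAt.comp {f g : ℂ → ℂ} {z : ℂ} (hg : DianalyticAt g (f z))
    (hf : DianalyticAt f z) : DianalyticAt (g ∘ f) z := by
  rcases hf with hf | hf <;> rcases hg with hg | hg
  · exact Or.inl (hg.comp hf)
  · exact Or.inr (hg.comp hf)
  · exact Or.inr (analyticAt_conj_comp (f := f) hg hf)
  · refine Or.inl ?_
    have := analyticAt_conj_comp (f := f) (g := fun w => starRingEnd ℂ (g w)) hg hf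
    simpa only [Complex.conj_conj] using! this

theorem DianalyticAt.congr {f g : ℂ → ℂ} {z : ℂ} (hf : DianalyticAt f z)
    (h : f =ᶠ[𝓝 z] g) : DianalyticAt g z := by
  rcases hf with hf | hf
  · exact Or.inl (hf.congr h)
  · exact Or.inr (hf.congr (h.fun_comp _))

/-- The pseudogroup of homeomorphisms between open subsets of `ℂ` which, near each point, are
holomorphic or anti-holomorphic. -/
def dianalyticGroupoid : StructureGroupoid ℂ :=
  Pregroupoid.groupoid
    { property := fun f s => ∀ z ∈ s, DianalyticAt f z
      comp := fun hf hg _ _ _ z hz => (hg _ hz.2).comp (hf z hz.1)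
      id_mem := fun _ _ => Or.inl analyticAt_id
      locality := fun _ h z hz => by
        obtain ⟨v, _, hzv, hv⟩ := h z hz
        exact hv z ⟨hz, hzv⟩
      congr := fun hu hfg hf z hz =>
        (hf z hz).congr (by filter_upwards [hu.mem_nhds hz] with w hw using (hfg w hw).symm) }

section Orientability

variable (Y : Type*) [TopologicalSpace Y] [ChartedSpace ℂ Y]

/-- Orientability of `Y` as a smooth real surface: there is an atlas of smooth charts all of whose
transition functions have positive Jacobian determinant. -/
def Orientable : Prop :=
  ∃ A ⊆ IsManifold.maximalAtlas 𝓘(ℝ, ℂ) ∞ Y,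
    (∀ y : Y, ∃ e ∈ A, y ∈ e.source) ∧
    ∀ e ∈ A, ∀ e' ∈ A, ∀ z ∈ (e.symm ≫ₕ e').source,
      0 < (fderiv ℝ (e.symm ≫ₕ e') z).det

/-- The compatible charts of a Klein surface: its maximal dianalytic atlas. -/
abbrev compatibleCharts : Set (OpenPartialHomeomorph Y ℂ) :=
  dianalyticGroupoid.maximalAtlas Y

end Orientability

variable {Y : Type*} [TopologicalSpace Y] [ChartedSpace ℂ Y]

theorem dianalyticAt_transition {e e' : OpenPartialHomeomorph Y ℂ} (he : e ∈ compatibleCharts Y)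
    (he' : e' ∈ compatibleCharts Y) {y : Y} (hy : y ∈ e.source) (hy' : y ∈ e'.source) :
    DianalyticAt (fun z => e' (e.symm z)) (e y) :=
  (dianalyticGroupoid.compatible_of_mem_maximalAtlas he he').1 (e y)
    (by simp [hy, hy'])

/-! ## The double cover by local orientations -/

/-- Two charts around `y` induce the same orientation at `y`: the transition function between them
is holomorphic near `y`. -/
def SameOrientationAt (e e' : OpenPartialHomeomorph Y ℂ) (y : Y) : Prop :=
  AnalyticAt ℂ (fun z => e' (e.symm z)) (e y)

theorem eventually_symm_mem {e e' : OpenPartialHomeomorph Y ℂ} {y : Y} (hy : y ∈ e.source)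
    (hy' : y ∈ e'.source) : ∀ᶠ z in 𝓝 (e y), e.symm z ∈ e'.source := by
  have h : Tendsto e.symm (𝓝 (e y)) (𝓝 y) := e.tendsto_symm hy
  exact h.eventually (e'.open_source.mem_nhds hy')

theorem SameOrientationAt.refl {e : OpenPartialHomeomorph Y ℂ} {y : Y} (hy : y ∈ e.source) :
    SameOrientationAt e e y := by
  refine analyticAt_id.congr ?_
  filter_upwards [e.open_target.mem_nhds (e.map_source hy)] with z hz
  exact (e.right_inv hz).symm

theorem SameOrientationAt.trans {e e' e'' : OpenPartialHomeomorph Y ℂ} {y : Y}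
    (hy : y ∈ e.source) (hy' : y ∈ e'.source)
    (h : SameOrientationAt e e' y) (h' : SameOrientationAt e' e'' y) :
    SameOrientationAt e e'' y := by
  have h'' : AnalyticAt ℂ (fun z => e'' (e'.symm (e' (e.symm z)))) (e y) :=
    AnalyticAt.fun_comp_of_eq (f := fun z => e' (e.symm z)) (g := fun z => e'' (e'.symm z))
      h' h (by simp [hy])
  refine h''.congr ?_
  filter_upwards [eventually_symm_mem hy hy'] with z hz
  rw [e'.left_inv hz]

theorem not_analyticAt_conj (z : ℂ) : ¬ AnalyticAt ℂ (fun w => starRingEnd ℂ w) z := fun h => by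
  have h1 : AnalyticAt ℂ (fun w : ℂ => ((w.re : ℝ) : ℂ)) z := by
    refine ((analyticAt_id.add h).const_smul (c := (1 / 2 : ℂ))).congr (Eventually.of_forall ?_)
    intro w
    simp [Complex.add_conj]
  have h2 : HasDerivAt (fun w : ℂ => ((w.re : ℝ) : ℂ)) _ z := h1.differentiableAt.hasDerivAt
  have h3 := h2.hasFDerivAt.restrictScalars ℝ
  have h4 : HasFDerivAt (fun w : ℂ => ((w.re : ℝ) : ℂ)) (Complex.ofRealCLM.comp Complex.reCLM) z :=
    (Complex.ofRealCLM.comp Complex.reCLM).hasFDerivAt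
  have h5 := h3.unique h4
  have h6 := congrArg (fun L => L 1) h5
  have h7 := congrArg (fun L => L I) h5
  simp at h6 h7
  simp [h6] at h7

theorem SameOrientationAt.symm {e e' : OpenPartialHomeomorph Y ℂ} (he : e ∈ compatibleCharts Y)
    (he' : e' ∈ compatibleCharts Y) {y : Y} (hy : y ∈ e.source) (hy' : y ∈ e'.source)
    (h : SameOrientationAt e e' y) : SameOrientationAt e' e y := by
  rcases dianalyticAt_transition he' he hy' hy with h' | h'
  · exact h'
  · exfalso
    have h'' : AnalyticAt ℂ (fun z => starRingEnd ℂ (e (e'.symm (e' (e.symm z))))) (e y) :=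
      AnalyticAt.fun_comp_of_eq (f := fun z => e' (e.symm z))
        (g := fun z => starRingEnd ℂ (e (e'.symm z))) h' h (by simp [hy])
    refine not_analyticAt_conj (e y) (h''.congr ?_)
    filter_upwards [eventually_symm_mem hy hy', e.open_target.mem_nhds (e.map_source hy)]
      with z hz hz'
    rw [e'.left_inv hz, e.right_inv hz']

variable (Y) in
/-- A point of `Y` together with a compatible chart around it. -/
def PointedChart : Type _ :=
  {p : OpenPartialHomeomorph Y ℂ × Y // p.1 ∈ compatibleCharts Y ∧ p.2 ∈ p.1.source}

variable (Y) in
/-- Two pointed charts agree if they have the same point and the same orientation there. -/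
def orientationSetoid : Setoid (PointedChart Y) where
  r p q := p.1.2 = q.1.2 ∧ SameOrientationAt p.1.1 q.1.1 p.1.2
  iseqv :=
    { refl := fun p => ⟨rfl, SameOrientationAt.refl p.2.2⟩
      symm := by
        rintro ⟨⟨e, y⟩, he, hy⟩ ⟨⟨e', y'⟩, he', hy'⟩ ⟨h1, h2⟩
        obtain rfl : y = y' := h1
        exact ⟨rfl, h2.symm he he' hy hy'⟩
      trans := by
        rintro ⟨⟨e, y⟩, he, hy⟩ ⟨⟨e', y'⟩, he', hy'⟩ ⟨⟨e'', y''⟩, he'', hy''⟩ ⟨h1, h2⟩ ⟨h3, h4⟩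
        obtain rfl : y = y' := h1
        obtain rfl : y = y'' := h3
        exact ⟨rfl, h2.trans hy hy' h4⟩ }

variable (Y) in
/-- The double cover `X` of `Y`: pairs of a point of `Y` and a local orientation at that point. -/
def OrientationCover : Type _ := Quotient (orientationSetoid Y)

namespace OrientationCover

/-- The point of `X` over `y` given by the orientation at `y` that the chart `e` induces. -/
def mk (e : OpenPartialHomeomorph Y ℂ) (he : e ∈ compatibleCharts Y) (y : Y)
    (hy : y ∈ e.source) : OrientationCover Y :=
  Quotient.mk (orientationSetoid Y) ⟨(e, y), he, hy⟩

theorem mk_eq_mk {e e' : OpenPartialHomeomorph Y ℂ} {he : e ∈ compatibleCharts Y}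
    {he' : e' ∈ compatibleCharts Y} {y y' : Y} {hy : y ∈ e.source} {hy' : y' ∈ e'.source} :
    mk e he y hy = mk e' he' y' hy' ↔ y = y' ∧ SameOrientationAt e e' y :=
  Quotient.eq (r := orientationSetoid Y)

/-- The covering map `π : X → Y`. -/
def proj : OrientationCover Y → Y :=
  Quotient.lift (fun p : PointedChart Y => p.1.2) fun _ _ h => h.1

@[simp] theorem proj_mk (e : OpenPartialHomeomorph Y ℂ) (he : e ∈ compatibleCharts Y) (y : Y)
    (hy : y ∈ e.source) : proj (mk e he y hy) = y := rfl

theorem exists_eq_mk (x : OrientationCover Y) : ∃ e he y hy, x = mk e he y hy := by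
  induction x using Quotient.ind with
  | _ p => exact ⟨p.1.1, p.2.1, p.1.2, p.2.2, rfl⟩

end OrientationCover

/-- The chart `e` followed by complex conjugation: it induces the opposite orientation. -/
def conjChart (e : OpenPartialHomeomorph Y ℂ) : OpenPartialHomeomorph Y ℂ :=
  e.transHomeomorph Complex.conjCLE.toHomeomorph

theorem mem_conjChart_source {e : OpenPartialHomeomorph Y ℂ} {y : Y} (hy : y ∈ e.source) :
    y ∈ (conjChart e).source := hy

theorem dianalyticAt_conj (z : ℂ) : DianalyticAt (fun w => starRingEnd ℂ w) z := by
  refine Or.inr ?_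
  simpa only [Complex.conj_conj] using! analyticAt_id

theorem conjChart_mem {e : OpenPartialHomeomorph Y ℂ} (he : e ∈ compatibleCharts Y) :
    conjChart e ∈ compatibleCharts Y := by
  intro e' he'
  obtain ⟨⟨h1, h2⟩, ⟨h3, h4⟩⟩ := he e' he'
  constructor
  · constructor
    · intro z hz
      exact DianalyticAt.comp (f := fun w => starRingEnd ℂ w) (h1 (starRingEnd ℂ z) hz)
        (dianalyticAt_conj z)
    · intro z hz
      exact DianalyticAt.comp (g := fun w => starRingEnd ℂ w) (dianalyticAt_conj _) (h2 z hz)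
  · constructor
    · intro z hz
      exact DianalyticAt.comp (g := fun w => starRingEnd ℂ w) (dianalyticAt_conj _) (h3 z hz)
    · intro z hz
      exact DianalyticAt.comp (f := fun w => starRingEnd ℂ w) (h4 (starRingEnd ℂ z) hz)
        (dianalyticAt_conj z)

namespace OrientationCover

/-- The involution `σ : X → X` given by change of orientation. -/
def involution : OrientationCover Y → OrientationCover Y :=
  Quotient.map' (s₁ := orientationSetoid Y) (s₂ := orientationSetoid Y)
    (fun p : PointedChart Y =>
      ⟨(conjChart p.1.1, p.1.2), conjChart_mem p.2.1, mem_conjChart_source p.2.2⟩)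
    (by
      rintro ⟨⟨e, y⟩, he, hy⟩ ⟨⟨e', y'⟩, he', hy'⟩ ⟨h1, h2⟩
      exact ⟨h1, analyticAt_conj_conj h2⟩)

theorem involution_mk (e : OpenPartialHomeomorph Y ℂ) (he : e ∈ compatibleCharts Y) (y : Y)
    (hy : y ∈ e.source) :
    involution (mk e he y hy) = mk (conjChart e) (conjChart_mem he) y (mem_conjChart_source hy) :=
  rfl

variable [HasGroupoid Y dianalyticGroupoid]

/-- A point of `X` over `y`: the orientation at `y` of the preferred chart at `y`. -/
def basePoint (y : Y) : OrientationCover Y :=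
  mk (chartAt ℂ y) (dianalyticGroupoid.chart_mem_maximalAtlas y) y (mem_chart_source ℂ y)

open Classical in
/-- A compatible chart `e` of `Y` defines a chart `e ∘ π` of `X` on the set of those points of `X`
whose orientation is the one induced by `e`. -/
def liftChart (e : OpenPartialHomeomorph Y ℂ) (he : e ∈ compatibleCharts Y) :
    PartialEquiv (OrientationCover Y) ℂ where
  toFun x := e (proj x)
  invFun z := if h : e.symm z ∈ e.source then mk e he (e.symm z) h else basePoint (e.symm z)
  source := {x | ∃ y hy, x = mk e he y hy}
  target := e.target
  map_source' := by
    rintro x ⟨y, hy, rfl⟩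
    exact e.map_source hy
  map_target' z hz := ⟨e.symm z, e.map_target hz, by simp [e.map_target hz]⟩
  left_inv' := by
    rintro x ⟨y, hy, rfl⟩
    have h : e.symm (e y) ∈ e.source := by rwa [e.left_inv hy]
    exact (dif_pos h).trans (mk_eq_mk.2 ⟨e.left_inv hy, SameOrientationAt.refl h⟩)
  right_inv' z hz := by
    simp [e.map_target hz, e.right_inv hz]

theorem liftChart_symm_apply (e : OpenPartialHomeomorph Y ℂ) (he : e ∈ compatibleCharts Y) {z : ℂ}
    (hz : z ∈ e.target) : (liftChart e he).symm z = mk e he (e.symm z) (e.map_target hz) :=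
  dif_pos (e.map_target hz)

theorem liftChart_trans_apply (e e' : OpenPartialHomeomorph Y ℂ) (he : e ∈ compatibleCharts Y)
    (he' : e' ∈ compatibleCharts Y) {z : ℂ} (hz : z ∈ e.target) :
    ((liftChart e he).symm.trans (liftChart e' he')) z = e' (e.symm z) := by
  change e' (proj ((liftChart e he).symm z)) = _
  rw [liftChart_symm_apply e he hz, proj_mk]

theorem liftChart_trans_source (e e' : OpenPartialHomeomorph Y ℂ) (he : e ∈ compatibleCharts Y)
    (he' : e' ∈ compatibleCharts Y) :
    ((liftChart e he).symm.trans (liftChart e' he')).source =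
      (e.symm ≫ₕ e').source ∩ {z | AnalyticAt ℂ (fun w => e' (e.symm w)) z} := by
  ext z
  change (z ∈ e.target ∧ (liftChart e he).symm z ∈ (liftChart e' he').source) ↔
    (z ∈ e.target ∧ e.symm z ∈ e'.source) ∧ _
  constructor
  · rintro ⟨hz, y, hy, h⟩
    rw [liftChart_symm_apply e he hz] at h
    obtain ⟨rfl, h2⟩ := mk_eq_mk.1 h
    refine ⟨⟨hz, hy⟩, ?_⟩
    rw [SameOrientationAt, e.right_inv hz] at h2
    exact h2
  · rintro ⟨⟨hz, hz'⟩, h⟩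
    refine ⟨hz, e.symm z, hz', ?_⟩
    rw [liftChart_symm_apply e he hz]
    refine mk_eq_mk.2 ⟨rfl, ?_⟩
    rw [SameOrientationAt, e.right_inv hz]
    exact h

variable (Y) in
/-- The charts `e ∘ π`, with `e` a compatible chart of `Y`, define the topology and the complex
structure of `X`. -/
def core : ChartedSpaceCore ℂ (OrientationCover Y) where
  atlas := {c | ∃ e he, c = liftChart e he}
  chartAt x := liftChart (Quotient.out x).1.1 (Quotient.out x).2.1
  mem_chart_source x :=
    ⟨(Quotient.out x).1.2, (Quotient.out x).2.2, (Quotient.out_eq x).symm⟩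
  chart_mem_atlas x := ⟨_, _, rfl⟩
  open_source := by
    rintro _ _ ⟨e, he, rfl⟩ ⟨e', he', rfl⟩
    rw [liftChart_trans_source]
    exact (e.symm ≫ₕ e').open_source.inter (isOpen_analyticAt ℂ _)
  continuousOn_toFun := by
    rintro _ _ ⟨e, he, rfl⟩ ⟨e', he', rfl⟩
    rw [liftChart_trans_source]
    refine ((e.symm ≫ₕ e').continuousOn.mono inter_subset_left).congr fun z hz => ?_
    exact liftChart_trans_apply e e' he he' hz.1.1

instance : TopologicalSpace (OrientationCover Y) := (core Y).toTopologicalSpace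

instance : ChartedSpace ℂ (OrientationCover Y) := (core Y).toChartedSpace

/-- The double cover is a Riemann surface. -/
instance : IsManifold 𝓘(ℂ) ω (OrientationCover Y) := by
  refine isManifold_of_contDiffOn _ _ _ fun c c' hc hc' => ?_
  obtain ⟨_, ⟨e, rfl⟩, _, ⟨⟨e, he, rfl⟩, rfl⟩, rfl⟩ := hc
  obtain ⟨_, ⟨e', rfl⟩, _, ⟨⟨e', he', rfl⟩, rfl⟩, rfl⟩ := hc'
  intro z hz
  have hz' : z ∈ ((liftChart e he).symm.trans (liftChart e' he')).source := hz.1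
  rw [liftChart_trans_source] at hz'
  refine (hz'.2.congr ?_).contDiffAt.contDiffWithinAt
  filter_upwards [e.open_target.mem_nhds hz'.1.1] with w hw
  exact (liftChart_trans_apply e e' he he' hw).symm

end OrientationCover

/-! ## The Riemann sphere and the closed upper half-plane -/

/-- The map `j` of the Riemann sphere induced by conjugation, with `j ∞ = ∞`. -/
def sphereConj : OnePoint ℂ → OnePoint ℂ := OnePoint.map (starRingEnd ℂ)

/-- The map `z ↦ 1 / z` of the Riemann sphere, exchanging `0` and `∞`. -/
def sphereInv (p : OnePoint ℂ) : OnePoint ℂ :=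
  p.elim ((0 : ℂ) : OnePoint ℂ) fun z => if z = 0 then OnePoint.infty else ((z⁻¹ : ℂ) : OnePoint ℂ)

/-- The standard coordinate on the Riemann sphere away from `∞` (with the junk value `0` at `∞`). -/
def sphereCoord (p : OnePoint ℂ) : ℂ := p.elim 0 id

/-- `F` is a holomorphic map to the Riemann sphere near `z`: in one of the two standard coordinates
`ζ` and `1 / ζ` of the sphere, it is a holomorphic function near `z`. -/
def SphereHolomorphicAt (F : ℂ → OnePoint ℂ) (z : ℂ) : Prop :=
  ∃ g : ℂ → ℂ, AnalyticAt ℂ g z ∧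
    ((∀ᶠ w in 𝓝 z, F w = (g w : OnePoint ℂ)) ∨
      (∀ᶠ w in 𝓝 z, sphereInv (F w) = (g w : OnePoint ℂ)))

open Classical in
/-- The multiplicity with which a holomorphic map `F` to the sphere takes the value `F z` at `z`
(with the junk value `0` where `F` is constant near `z`). -/
def sphereMult (F : ℂ → OnePoint ℂ) (z : ℂ) : ℕ :=
  if F z = OnePoint.infty then analyticOrderNatAt (fun w => sphereCoord (sphereInv (F w))) z
  else analyticOrderNatAt (fun w => sphereCoord (F w) - sphereCoord (F z)) z

theorem sphereConj_sphereConj (p : OnePoint ℂ) : sphereConj (sphereConj p) = p := by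
  induction p using OnePoint.rec with
  | infty => rfl
  | coe z => exact congrArg _ (Complex.conj_conj z)

/-- The orbit relation of the group generated by `j` on the Riemann sphere. -/
def conjSetoid : Setoid (OnePoint ℂ) where
  r p q := q = p ∨ q = sphereConj p
  iseqv :=
    { refl := fun _ => Or.inl rfl
      symm := by
        rintro p q (rfl | rfl)
        · exact Or.inl rfl
        · exact Or.inr (sphereConj_sphereConj p).symm
      trans := by
        rintro p q r (rfl | rfl) (rfl | rfl)
        · exact Or.inl rfl
        · exact Or.inr rfl
        · exact Or.inr rfl
        · exact Or.inl (sphereConj_sphereConj p) }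

/-- The closure of the upper half-plane in the Riemann sphere, as the quotient of the Riemann
sphere by conjugation, with the quotient topology. -/
abbrev ClosedHalfPlane : Type := Quotient conjSetoid

/-- The quotient map from the Riemann sphere to the closed upper half-plane. -/
def toHalfPlane (p : OnePoint ℂ) : ClosedHalfPlane := Quotient.mk conjSetoid p

/-! ## Divisors -/

/-- Divisors on `S`: finite formal sums of points with integer coefficients. -/
abbrev Divisor (S : Type*) : Type _ := S →₀ ℤ

/-- The degree of a divisor. -/
def Divisor.degree {S : Type*} (D : Divisor S) : ℤ := D.sum fun _ n => n

/-- The action `σ^*` of the involution on divisors of `X`: `∑ m_j x_j ↦ ∑ m_j σ(x_j)`. -/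
def Divisor.involution (E : Divisor (OrientationCover Y)) : Divisor (OrientationCover Y) :=
  Finsupp.mapDomain OrientationCover.involution E

/-- The pullback `π^*`: `∑ n_j y_j ↦ ∑ n_j (x_j + σ(x_j))`, where `x_j` is a point over `y_j`. -/
def Divisor.pullback [HasGroupoid Y dianalyticGroupoid] (D : Divisor Y) :
    Divisor (OrientationCover Y) :=
  D.sum fun y n => Finsupp.single (OrientationCover.basePoint y) n +
    Finsupp.single (OrientationCover.involution (OrientationCover.basePoint y)) n

/-! ### Principal divisors on a Riemann surface -/

section RiemannSurface

variable {X : Type*} [TopologicalSpace X] [ChartedSpace ℂ X]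

/-- `f` is a holomorphic map from `X` to the Riemann sphere. -/
def IsHolomorphicToSphere (f : X → OnePoint ℂ) : Prop :=
  ∀ c ∈ atlas ℂ X, ∀ z ∈ c.target, SphereHolomorphicAt (f ∘ c.symm) z

/-- A nonzero meromorphic function on a connected Riemann surface `X`: a holomorphic map to the
Riemann sphere which is not identically `0` and not identically `∞`. -/
structure IsNonzeroMeromorphic (f : X → OnePoint ℂ) : Prop where
  holomorphic : IsHolomorphicToSphere f
  ne_zero : ∃ x, f x ≠ ((0 : ℂ) : OnePoint ℂ)
  ne_infty : ∃ x, f x ≠ OnePoint.infty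

/-- The multiplicity of the holomorphic map `f` at the point `x`. -/
def multAt (f : X → OnePoint ℂ) (x : X) : ℕ :=
  sphereMult (f ∘ (chartAt ℂ x).symm) (chartAt ℂ x x)

open Classical in
/-- The coefficients of the divisor `div(f)`: multiplicities of zeros minus multiplicities
of poles. -/
def divCoeff (f : X → OnePoint ℂ) (x : X) : ℤ :=
  (if f x = ((0 : ℂ) : OnePoint ℂ) then (multAt f x : ℤ) else 0) -
    (if f x = OnePoint.infty then (multAt f x : ℤ) else 0)

/-- `E` is a principal divisor on `X`: the divisor of a nonzero meromorphic function. -/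
def IsPrincipal (E : Divisor X) : Prop :=
  ∃ f : X → OnePoint ℂ, IsNonzeroMeromorphic f ∧ ∀ x, E x = divCoeff f x

end RiemannSurface

/-! ### Morphisms to the closed upper half-plane and principal divisors on a Klein surface -/

/-- `F` is a holomorphic map to the Riemann sphere, defined on the image of the chart `e`, which
represents `u` on the domain of `e` after folding the sphere onto the closed half-plane. -/
structure IsLocalLift (u : Y → ClosedHalfPlane) (e : OpenPartialHomeomorph Y ℂ)
    (F : ℂ → OnePoint ℂ) : Prop where
  holomorphic : ∀ z ∈ e.target, SphereHolomorphicAt F z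
  fold : ∀ y ∈ e.source, u y = toHalfPlane (F (e y))

/-- The compatible charts of `Y` with image in the open upper half-plane. -/
def halfPlaneCharts (Y : Type*) [TopologicalSpace Y] [ChartedSpace ℂ Y] :
    Set (OpenPartialHomeomorph Y ℂ) :=
  {e | e ∈ compatibleCharts Y ∧ e.target ⊆ {z : ℂ | 0 < z.im}}

/-- `u` is a morphism from `Y` to the closed upper half-plane. -/
structure IsMorphism (u : Y → ClosedHalfPlane) : Prop where
  continuous : Continuous u
  exists_lift : ∀ e ∈ halfPlaneCharts Y, ∃ F, IsLocalLift u e F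

/-- The multiplicity of the morphism `u` at `y`: the multiplicity of a local lift `F` at the image
of `y`. (For a non-constant morphism it does not depend on the chart and on the lift; the infimum
just selects the common value.) -/
def morphismMult (u : Y → ClosedHalfPlane) (y : Y) : ℕ :=
  sInf {n | ∃ e ∈ halfPlaneCharts Y, y ∈ e.source ∧
    ∃ F, IsLocalLift u e F ∧ n = sphereMult F (e y)}

open Classical in
/-- The coefficients of the divisor `u⁻¹(p)`: the multiplicity of `u` at the points over `p`. -/
def fibreCoeff (u : Y → ClosedHalfPlane) (p : ClosedHalfPlane) (y : Y) : ℤ :=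
  if u y = p then (morphismMult u y : ℤ) else 0

/-- The coefficients of the divisor `div(u) = u⁻¹(0) - u⁻¹(∞)`. -/
def morphismDivCoeff (u : Y → ClosedHalfPlane) (y : Y) : ℤ :=
  fibreCoeff u (toHalfPlane ((0 : ℂ) : OnePoint ℂ)) y - fibreCoeff u (toHalfPlane OnePoint.infty) y

/-- `D` is a principal divisor on the Klein surface `Y`: the divisor of a morphism to the closed
upper half-plane which is not identically `0` and not identically `∞`. -/
def IsKleinPrincipal (D : Divisor Y) : Prop :=
  ∃ u : Y → ClosedHalfPlane, IsMorphism u ∧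
    (∃ y, u y ≠ toHalfPlane ((0 : ℂ) : OnePoint ℂ)) ∧ (∃ y, u y ≠ toHalfPlane OnePoint.infty) ∧
    ∀ y, D y = morphismDivCoeff u y

end KleinSurface

end

noncomputable section

open Set Filter Topology Complex
open scoped Manifold ContDiff

set_option linter.unusedSectionVars false

namespace KleinSurface

/-! ### Holomorphic maps to the Riemann sphere, their folding by `j` and their multiplicities -/

section Sphere

/-! ## The Riemann sphere -/

/-! Going up: let `u` be a nonconstant morphism. Two holomorphic lifts of `u` in one chart agree up
to conjugation at each point. If they were conjugate near a point, a holomorphic function and its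
conjugate would both be holomorphic, hence constant; so the lifts agree
(`SphereHolomorphicAt.eventually_eq_or_const`). A lift is therefore determined by the orientation of
its chart, and the lifts glue to a holomorphic `f` on `X` with `u ∘ π = p ∘ f`
(`IsMorphism.exists_lift_orientationCover`). Reflecting a chart in the imaginary axis reverses its
orientation and conjugates the lift, whence `f ∘ σ = j ∘ f`. Multiplicities at zeros and poles
depend only on absolute values, and transition maps are bi-Lipschitz, so `π^*` of `div(u)` is
`div(f)`. A constant `u` has divisor zero, and `f = 1` serves.

Going down: let `π^*D = div(f)`. As `π^*D` is `σ`-invariant, `j ∘ f ∘ σ` has the same divisor as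
`f`. Nonorientability makes `X` connected, and `X` is compact, so `j ∘ f ∘ σ = c f` for a constant
`c` (`IsNonzeroMeromorphic.exists_sphereCoord_eq_mul`). Applying this at `x` and at `σ x` gives `|c|
= 1`. For `l ^ 2 = c` the function `l f` is symmetric with the same divisor, and `p ∘ (l f)`
descends to a morphism on `Y` with divisor `D`. -/

@[simp] theorem sphereInv_infty : sphereInv OnePoint.infty = ((0 : ℂ) : OnePoint ℂ) := rfl

@[simp] theorem sphereInv_zero : sphereInv ((0 : ℂ) : OnePoint ℂ) = OnePoint.infty := if_pos rfl

theorem sphereInv_coe {z : ℂ} (hz : z ≠ 0) : sphereInv (z : OnePoint ℂ) = ((z⁻¹ : ℂ) : OnePoint ℂ) :=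
  if_neg hz

@[simp] theorem sphereCoord_coe (z : ℂ) : sphereCoord (z : OnePoint ℂ) = z := rfl

@[simp] theorem sphereCoord_infty : sphereCoord OnePoint.infty = 0 := rfl

@[simp] theorem sphereConj_infty : sphereConj OnePoint.infty = OnePoint.infty := rfl

@[simp] theorem sphereConj_coe (z : ℂ) :
    sphereConj (z : OnePoint ℂ) = ((starRingEnd ℂ z : ℂ) : OnePoint ℂ) := rfl

@[simp] theorem sphereInv_sphereInv (p : OnePoint ℂ) : sphereInv (sphereInv p) = p := by
  induction p using OnePoint.rec with
  | infty => simp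
  | coe z =>
    rcases eq_or_ne z 0 with rfl | hz
    · simp
    · rw [sphereInv_coe hz, sphereInv_coe (inv_ne_zero hz), inv_inv]

theorem sphereInv_injective : Function.Injective sphereInv :=
  Function.LeftInverse.injective sphereInv_sphereInv

@[simp] theorem sphereInv_eq_infty {p : OnePoint ℂ} :
    sphereInv p = OnePoint.infty ↔ p = ((0 : ℂ) : OnePoint ℂ) := by
  rw [← sphereInv_zero, sphereInv_injective.eq_iff]

@[simp] theorem sphereInv_eq_zero {p : OnePoint ℂ} :
    sphereInv p = ((0 : ℂ) : OnePoint ℂ) ↔ p = OnePoint.infty := by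
  rw [← sphereInv_infty, sphereInv_injective.eq_iff]

@[simp] theorem sphereCoord_sphereInv (p : OnePoint ℂ) :
    sphereCoord (sphereInv p) = (sphereCoord p)⁻¹ := by
  induction p using OnePoint.rec with
  | infty => simp
  | coe z =>
    rcases eq_or_ne z 0 with rfl | hz
    · simp
    · simp [sphereInv_coe hz]

theorem coe_sphereCoord {p : OnePoint ℂ} (hp : p ≠ OnePoint.infty) :
    (sphereCoord p : OnePoint ℂ) = p := by
  induction p using OnePoint.rec with
  | infty => exact absurd rfl hp
  | coe z => rfl

theorem sphereConj_sphereInv (p : OnePoint ℂ) :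
    sphereConj (sphereInv p) = sphereInv (sphereConj p) := by
  induction p using OnePoint.rec with
  | infty => simp
  | coe z =>
    rcases eq_or_ne z 0 with rfl | hz
    · simp
    · have hz' : starRingEnd ℂ z ≠ 0 := by simpa using hz
      simp [sphereInv_coe hz, sphereInv_coe hz']

theorem continuous_sphereInv : Continuous sphereInv := by
  rw [continuous_iff_continuousAt]
  intro p
  induction p using OnePoint.rec with
  | infty =>
    rw [OnePoint.continuousAt_infty', sphereInv_infty, coclosedCompact_eq_cocompact,
      ← Metric.cobounded_eq_cocompact]
    refine ((OnePoint.continuous_coe.tendsto (0 : ℂ)).comp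
      (tendsto_inv₀_cobounded (α := ℂ))).congr' ?_
    filter_upwards [Bornology.eventually_ne_cobounded (0 : ℂ)] with z hz
    exact (sphereInv_coe hz).symm
  | coe z =>
    rw [OnePoint.continuousAt_coe]
    rcases eq_or_ne z 0 with rfl | hz
    · rw [ContinuousAt, ← nhdsNE_sup_pure, tendsto_sup]
      constructor
      · have h1 : Tendsto (fun w : ℂ => w⁻¹) (𝓝[≠] 0) (coclosedCompact ℂ) := by
          rw [coclosedCompact_eq_cocompact, ← Metric.cobounded_eq_cocompact]
          exact tendsto_inv₀_nhdsNE_zero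
        have h2 := (OnePoint.tendsto_coe_infty (X := ℂ)).comp h1
        simp only [Function.comp_apply, sphereInv_zero]
        refine h2.congr' ?_
        filter_upwards [self_mem_nhdsWithin] with w hw
        exact (sphereInv_coe hw).symm
      · exact tendsto_pure_nhds _ _
    · have h1 : ContinuousAt (fun w : ℂ => ((w⁻¹ : ℂ) : OnePoint ℂ)) z :=
        OnePoint.continuous_coe.continuousAt.comp (continuousAt_inv₀ hz)
      refine h1.congr ?_
      filter_upwards [eventually_ne_nhds hz] with w hw
      exact (sphereInv_coe hw).symm

theorem toHalfPlane_eq_iff {p q : OnePoint ℂ} :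
    toHalfPlane p = toHalfPlane q ↔ q = p ∨ q = sphereConj p :=
  Quotient.eq (r := conjSetoid)

@[simp] theorem toHalfPlane_sphereConj (p : OnePoint ℂ) :
    toHalfPlane (sphereConj p) = toHalfPlane p :=
  (toHalfPlane_eq_iff.2 (Or.inr rfl)).symm

theorem exists_toHalfPlane_eq (v : ClosedHalfPlane) : ∃ p, toHalfPlane p = v :=
  Quotient.exists_rep v

theorem toHalfPlane_eq_infty {p : OnePoint ℂ} :
    toHalfPlane p = toHalfPlane OnePoint.infty ↔ p = OnePoint.infty := by
  rw [eq_comm, toHalfPlane_eq_iff]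
  simp

theorem toHalfPlane_eq_zero {p : OnePoint ℂ} :
    toHalfPlane p = toHalfPlane ((0 : ℂ) : OnePoint ℂ) ↔ p = ((0 : ℂ) : OnePoint ℂ) := by
  rw [eq_comm, toHalfPlane_eq_iff]
  simp

theorem toHalfPlane_sphereInv {p q : OnePoint ℂ} (h : toHalfPlane p = toHalfPlane q) :
    toHalfPlane (sphereInv p) = toHalfPlane (sphereInv q) := by
  rcases toHalfPlane_eq_iff.1 h with rfl | rfl
  · rfl
  · rw [← sphereConj_sphereInv, toHalfPlane_sphereConj]

/-- Two points of the sphere have the same absolute value in `[0, ∞]`. -/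
def SphereNormEq (p q : OnePoint ℂ) : Prop :=
  (p = OnePoint.infty ↔ q = OnePoint.infty) ∧ ‖sphereCoord p‖ = ‖sphereCoord q‖

/-- The clause on `∞` in `SphereNormEq` is what separates `0` from `∞`, since `sphereCoord` vanishes
at both. -/
theorem SphereNormEq.eq_zero_iff {p q : OnePoint ℂ} (h : SphereNormEq p q) :
    p = ((0 : ℂ) : OnePoint ℂ) ↔ q = ((0 : ℂ) : OnePoint ℂ) := by
  obtain ⟨h1, h2⟩ := h
  induction p using OnePoint.rec with
  | infty => simp [h1.1 rfl]
  | coe z =>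
    induction q using OnePoint.rec with
    | infty => simp at h1
    | coe w =>
      simp only [sphereCoord_coe] at h2
      rw [OnePoint.coe_eq_coe, OnePoint.coe_eq_coe, ← norm_eq_zero, h2, norm_eq_zero]

theorem SphereNormEq.sphereInv {p q : OnePoint ℂ} (h : SphereNormEq p q) :
    SphereNormEq (sphereInv p) (sphereInv q) := by
  refine ⟨?_, ?_⟩
  · rw [sphereInv_eq_infty, sphereInv_eq_infty, h.eq_zero_iff]
  · simp [h.2]

/-- Conjugation preserves absolute values, so multiplicities can be compared without knowing which
of two conjugate lifts is at hand. -/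
theorem sphereNormEq_of_toHalfPlane_eq {p q : OnePoint ℂ} (h : toHalfPlane p = toHalfPlane q) :
    SphereNormEq p q := by
  rcases toHalfPlane_eq_iff.1 h with rfl | rfl
  · exact ⟨Iff.rfl, rfl⟩
  · induction p using OnePoint.rec with
    | infty => simp [SphereNormEq]
    | coe z => simp [SphereNormEq]

/-! ## Holomorphic maps to the sphere -/

theorem SphereHolomorphicAt.congr {F G : ℂ → OnePoint ℂ} {z : ℂ} (hF : SphereHolomorphicAt F z)
    (h : F =ᶠ[𝓝 z] G) : SphereHolomorphicAt G z := by
  obtain ⟨g, hg, h' | h'⟩ := hF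
  · exact ⟨g, hg, Or.inl (by filter_upwards [h, h'] with w h1 h2; rw [← h1, h2])⟩
  · exact ⟨g, hg, Or.inr (by filter_upwards [h, h'] with w h1 h2; rw [← h1, h2])⟩

theorem sphereHolomorphicAt_const (p : OnePoint ℂ) (z : ℂ) :
    SphereHolomorphicAt (fun _ => p) z := by
  induction p using OnePoint.rec with
  | infty => exact ⟨fun _ => 0, analyticAt_const, Or.inr (Eventually.of_forall fun _ => rfl)⟩
  | coe a => exact ⟨fun _ => a, analyticAt_const, Or.inl (Eventually.of_forall fun _ => rfl)⟩

theorem SphereHolomorphicAt.sphereInv {F : ℂ → OnePoint ℂ} {z : ℂ}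
    (hF : SphereHolomorphicAt F z) : SphereHolomorphicAt (fun w => sphereInv (F w)) z := by
  obtain ⟨g, hg, h | h⟩ := hF
  · exact ⟨g, hg, Or.inr (by filter_upwards [h] with w hw; simpa using hw)⟩
  · exact ⟨g, hg, Or.inl h⟩

theorem SphereHolomorphicAt.comp_analyticAt {F : ℂ → OnePoint ℂ} {T : ℂ → ℂ} {z : ℂ}
    (hF : SphereHolomorphicAt F (T z)) (hT : AnalyticAt ℂ T z) :
    SphereHolomorphicAt (fun w => F (T w)) z := by
  obtain ⟨g, hg, h⟩ := hF
  exact ⟨fun w => g (T w), hg.fun_comp hT,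
    h.imp (fun h => hT.continuousAt.eventually h) fun h => hT.continuousAt.eventually h⟩

theorem SphereHolomorphicAt.conj_conj {F : ℂ → OnePoint ℂ} {z : ℂ}
    (hF : SphereHolomorphicAt F (starRingEnd ℂ z)) :
    SphereHolomorphicAt (fun w => sphereConj (F (starRingEnd ℂ w))) z := by
  obtain ⟨g, hg, h⟩ := hF
  have hg' := analyticAt_conj_conj hg
  rw [Complex.conj_conj] at hg'
  have hc := (Complex.continuous_conj.tendsto z)
  refine ⟨_, hg', h.imp (fun h => ?_) fun h => ?_⟩
  · filter_upwards [hc.eventually h] with w hw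
    rw [hw, sphereConj_coe]
  · filter_upwards [hc.eventually h] with w hw
    rw [← sphereConj_sphereInv, hw, sphereConj_coe]

/-- Away from poles the coordinate `1 / ζ` does not vanish and can be inverted. -/
theorem SphereHolomorphicAt.exists_eventually_eq_coe {F : ℂ → OnePoint ℂ} {z : ℂ}
    (hF : SphereHolomorphicAt F z) (hz : F z ≠ OnePoint.infty) :
    ∃ g : ℂ → ℂ, AnalyticAt ℂ g z ∧ ∀ᶠ w in 𝓝 z, F w = (g w : OnePoint ℂ) := by
  obtain ⟨g, hg, h | h⟩ := hF
  · exact ⟨g, hg, h⟩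
  · have h0 : g z ≠ 0 := by
      intro h0
      have := h.self_of_nhds
      rw [h0, sphereInv_eq_zero] at this
      exact hz this
    refine ⟨fun w => (g w)⁻¹, hg.inv h0, ?_⟩
    filter_upwards [h, hg.continuousAt.eventually_ne h0] with w hw hw0
    rw [← sphereInv_coe hw0, ← hw, sphereInv_sphereInv]

theorem SphereHolomorphicAt.analyticAt_sphereCoord {F : ℂ → OnePoint ℂ} {z : ℂ}
    (hF : SphereHolomorphicAt F z) (hz : F z ≠ OnePoint.infty) :
    AnalyticAt ℂ (fun w => sphereCoord (F w)) z := by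
  obtain ⟨g, hg, h⟩ := hF.exists_eventually_eq_coe hz
  refine hg.congr ?_
  filter_upwards [h] with w hw
  rw [hw, sphereCoord_coe]

theorem SphereHolomorphicAt.eventually_ne_infty {F : ℂ → OnePoint ℂ} {z : ℂ}
    (hF : SphereHolomorphicAt F z) (hz : F z ≠ OnePoint.infty) :
    ∀ᶠ w in 𝓝 z, F w ≠ OnePoint.infty := by
  obtain ⟨g, -, h⟩ := hF.exists_eventually_eq_coe hz
  filter_upwards [h] with w hw
  simp [hw]

theorem SphereHolomorphicAt.continuousAt {F : ℂ → OnePoint ℂ} {z : ℂ}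
    (hF : SphereHolomorphicAt F z) : ContinuousAt F z := by
  obtain ⟨g, hg, h | h⟩ := hF
  · exact (OnePoint.continuous_coe.continuousAt.comp hg.continuousAt).congr
      (h.mono fun w hw => hw.symm)
  · refine ((continuous_sphereInv.comp OnePoint.continuous_coe).continuousAt.comp
      hg.continuousAt).congr (h.mono fun w hw => ?_)
    simp only [Function.comp_apply]
    rw [← hw, sphereInv_sphereInv]

/-- The identity theorem: a holomorphic map to the sphere taking a value at points accumulating
at `z` is constant near `z`. -/
theorem SphereHolomorphicAt.eventually_eq_of_frequently {F : ℂ → OnePoint ℂ} {z : ℂ}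
    (hF : SphereHolomorphicAt F z) {p : OnePoint ℂ} (h : ∃ᶠ w in 𝓝[≠] z, F w = p) :
    ∀ᶠ w in 𝓝 z, F w = p := by
  have key : ∀ {F : ℂ → OnePoint ℂ} {p : OnePoint ℂ} {g : ℂ → ℂ}, AnalyticAt ℂ g z →
      (∀ᶠ w in 𝓝 z, F w = (g w : OnePoint ℂ)) → (∃ᶠ w in 𝓝[≠] z, F w = p) →
      ∀ᶠ w in 𝓝 z, F w = p := by
    intro F p g hg hFg h
    have h' := h.and_eventually (hFg.filter_mono nhdsWithin_le_nhds)
    induction p using OnePoint.rec with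
    | infty =>
      obtain ⟨w, hw, hw'⟩ := h'.exists
      simp [hw] at hw'
    | coe a =>
      have h2 : ∃ᶠ w in 𝓝[≠] z, g w = a := h'.mono fun w hw => by
        rw [← OnePoint.coe_eq_coe, ← hw.2, hw.1]
      have h3 := (hg.frequently_eq_iff_eventually_eq analyticAt_const).1 h2
      filter_upwards [h3, hFg] with w h4 h5
      rw [h5, h4]
  obtain ⟨g, hg, h' | h'⟩ := hF
  · exact key hg h' h
  -- In the coordinate `1 / ζ`, the argument applies to the inverted map and the inverted value.
  · have := key hg h' (p := KleinSurface.sphereInv p) (h.mono fun w hw => by rw [hw])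
    filter_upwards [this] with w hw using sphereInv_injective hw

/-- A real-valued analytic function is locally constant. -/
theorem eventually_const_of_analyticAt_of_real {g : ℂ → ℂ} {z : ℂ} (hg : AnalyticAt ℂ g z)
    (h : ∀ᶠ w in 𝓝 z, (g w).im = 0) : ∀ᶠ w in 𝓝 z, g w = g z := by
  rcases hg.eventually_constant_or_nhds_le_map_nhds with h' | h'
  · exact h'
  · exfalso
    -- The open mapping alternative: `g` sends neighbourhoods of `z` to neighbourhoods of `g z`, and
    -- these contain the non-real points `g z + t * I` for small `t ≠ 0`.
    have h1 : ∀ᶠ v in 𝓝 (g z), v.im = 0 := h' (mem_map.2 h)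
    have h0 : (g z).im = 0 := h.self_of_nhds
    have h2 : Tendsto (fun t : ℝ => g z + t * I) (𝓝 0) (𝓝 (g z)) := by
      have : Continuous fun t : ℝ => g z + t * I := by fun_prop
      simpa using this.tendsto 0
    have h3 := (h2.eventually h1).filter_mono (nhdsWithin_le_nhds (s := {0}ᶜ))
    obtain ⟨t, ht, ht'⟩ := (h3.and self_mem_nhdsWithin).exists
    simp [h0] at ht
    exact ht' ht

/-- The sum of `g` and its conjugate, and `I` times their difference, are real-valued and
holomorphic, hence locally constant. -/
theorem eventually_const_of_analyticAt_conj {g : ℂ → ℂ} {z : ℂ} (hg : AnalyticAt ℂ g z)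
    (hg' : AnalyticAt ℂ (fun w => starRingEnd ℂ (g w)) z) : ∀ᶠ w in 𝓝 z, g w = g z := by
  have h1 := eventually_const_of_analyticAt_of_real (hg.add hg')
    (Eventually.of_forall fun w => by simp)
  have h2 := eventually_const_of_analyticAt_of_real ((hg.sub hg').mul (analyticAt_const (v := I)))
    (Eventually.of_forall fun w => by simp)
  filter_upwards [h1, h2] with w hw1 hw2
  have hw2' := mul_right_cancel₀ I_ne_zero hw2
  simp only [Pi.add_apply, Pi.sub_apply] at hw1 hw2'
  linear_combination (hw1 + hw2') / 2

/-- Two holomorphic maps to the sphere with the same image in the closed half-plane agree, unless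
they are constant. -/
theorem SphereHolomorphicAt.eventually_eq_or_const {F G : ℂ → OnePoint ℂ} {z : ℂ}
    (hF : SphereHolomorphicAt F z) (hG : SphereHolomorphicAt G z)
    (h : ∀ᶠ w in 𝓝 z, toHalfPlane (F w) = toHalfPlane (G w)) :
    F =ᶠ[𝓝 z] G ∨ ∀ᶠ w in 𝓝 z, F w = F z := by
  have key : ∀ {F G : ℂ → OnePoint ℂ}, SphereHolomorphicAt F z → SphereHolomorphicAt G z →
      (∀ᶠ w in 𝓝 z, toHalfPlane (F w) = toHalfPlane (G w)) → F z ≠ OnePoint.infty →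
      F =ᶠ[𝓝 z] G ∨ ∀ᶠ w in 𝓝 z, F w = F z := by
    intro F G hF hG h hz
    have hz' : G z ≠ OnePoint.infty := by
      exact fun hz' => hz ((sphereNormEq_of_toHalfPlane_eq h.self_of_nhds).1.2 hz')
    obtain ⟨f, hf, hf'⟩ := hF.exists_eventually_eq_coe hz
    obtain ⟨g, hg, hg'⟩ := hG.exists_eventually_eq_coe hz'
    have hfg : ∀ᶠ w in 𝓝 z, g w = f w ∨ g w = starRingEnd ℂ (f w) := by
      filter_upwards [hf', hg', h] with w h1 h2 h3
      rw [h1, h2, toHalfPlane_eq_iff] at h3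
      simpa using h3
    -- Either `f` and `g` agree at points accumulating at `z`, and the identity theorem applies; or
    -- `g` is the conjugate of `f` off `z`, by continuity also at `z`, and then `f` and its
    -- conjugate are both holomorphic.
    by_cases hfr : ∃ᶠ w in 𝓝[≠] z, f w = g w
    · left
      have := (hf.frequently_eq_iff_eventually_eq hg).1 hfr
      filter_upwards [this, hf', hg'] with w h1 h2 h3
      rw [h2, h3, h1]
    · right
      rw [not_frequently] at hfr
      have hne : ∀ᶠ w in 𝓝[≠] z, g w = starRingEnd ℂ (f w) := by
        filter_upwards [hfr, hfg.filter_mono nhdsWithin_le_nhds] with w h1 h2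
        exact h2.resolve_left (Ne.symm h1)
      have hcf : ContinuousAt (fun w => starRingEnd ℂ (f w)) z :=
        Complex.continuous_conj.continuousAt.comp hf.continuousAt
      have heq : ∀ᶠ w in 𝓝 z, g w = starRingEnd ℂ (f w) :=
        (hg.continuousAt.eventuallyEq_nhds_iff_eventuallyEq_nhdsNE hcf).1 hne
      have hc := eventually_const_of_analyticAt_conj hf (hg.congr heq)
      filter_upwards [hc, hf'] with w h1 h2
      rw [h2, h1, hf'.self_of_nhds]
  by_cases hz : F z = OnePoint.infty
  · have := key hF.sphereInv hG.sphereInv (h.mono fun w hw => toHalfPlane_sphereInv hw)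
      (by simp [hz])
    refine this.imp (fun h => ?_) fun h => ?_
    · filter_upwards [h] with w hw using sphereInv_injective hw
    · filter_upwards [h] with w hw using sphereInv_injective hw
  · exact key hF hG h hz

/-! ## Multiplicities -/

/-- The order of vanishing depends only on the absolute value, and is invariant under bi-Lipschitz
changes of coordinates. -/
theorem analyticOrderNatAt_eq_of_norm_eq {f g T : ℂ → ℂ} {z z' : ℂ} (hf : AnalyticAt ℂ f z)
    (hg : AnalyticAt ℂ g z') (hT : Tendsto T (𝓝 z) (𝓝 z'))
    (hT' : (fun w => T w - z') =Θ[𝓝 z] fun w => w - z)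
    (h : ∀ᶠ w in 𝓝 z, ‖g (T w)‖ = ‖f w‖) : analyticOrderNatAt f z = analyticOrderNatAt g z' := by
  -- A function of finite order `n` at `a` is comparable to `(w - a) ^ n`; the order is then read
  -- off from growth alone.
  have order_theta : ∀ {k : ℂ → ℂ} {a : ℂ}, AnalyticAt ℂ k a → analyticOrderAt k a ≠ ⊤ →
      k =Θ[𝓝 a] fun w => (w - a) ^ analyticOrderNatAt k a := by
    intro k a hk hk'
    obtain ⟨b, hb, hb0, hkb⟩ := hk.analyticOrderAt_ne_top.1 hk'
    have h1 : b =Θ[𝓝 a] fun _ => (1 : ℂ) :=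
      ((Asymptotics.isEquivalent_const_iff_tendsto hb0).2 hb.continuousAt.tendsto).isTheta.trans
        (Asymptotics.isTheta_const_const hb0 one_ne_zero)
    have h2 := (Asymptotics.isTheta_refl (fun w => (w - a) ^ analyticOrderNatAt k a) (𝓝 a)).mul h1
    simp only [mul_one] at h2
    refine EventuallyEq.trans_isTheta ?_ h2
    filter_upwards [hkb] with w hw
    rw [hw, smul_eq_mul]
  have hfg : f =Θ[𝓝 z] fun w => g (T w) :=
    Asymptotics.IsTheta.of_norm_eventuallyEq_norm (h.mono fun w hw => hw.symm)
  -- `analyticOrderNatAt` sends order `⊤` to `0`, so infinite order has to be matched on both sides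
  -- separately.
  by_cases hgt : analyticOrderAt g z' = ⊤
  · have hft : analyticOrderAt f z = ⊤ := by
      rw [analyticOrderAt_eq_top] at hgt ⊢
      filter_upwards [h, hT.eventually hgt] with w h1 h2
      rw [h2, norm_zero] at h1
      exact norm_eq_zero.1 h1.symm
    simp [analyticOrderNatAt, hgt, hft]
  · have hgT : f =Θ[𝓝 z] fun w => (w - z) ^ analyticOrderNatAt g z' :=
      (hfg.trans ⟨(order_theta hg hgt).1.comp_tendsto hT,
        (order_theta hg hgt).2.comp_tendsto hT⟩).trans (hT'.pow _)
    have hft : analyticOrderAt f z ≠ ⊤ := by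
      intro hft
      rw [analyticOrderAt_eq_top] at hft
      have h3 := (Asymptotics.IsTheta.symm
        (EventuallyEq.trans_isTheta (EventuallyEq.symm hft) hgT)).eq_zero_iff
      obtain ⟨w, hw, hw'⟩ := ((h3.filter_mono nhdsWithin_le_nhds).and
        (self_mem_nhdsWithin (a := z) (s := {z}ᶜ))).exists
      exact pow_ne_zero _ (sub_ne_zero.2 hw') (hw.2 rfl)
    have h4 := ((order_theta hf hft).symm.trans hgT).mono (nhdsWithin_le_nhds (s := {z}ᶜ))
    -- Different powers of `w - z` are not comparable near `z`, so the exponent is determined.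
    have key : ∀ m n : ℕ, m < n → ¬ (fun w : ℂ => (w - z) ^ m) =O[𝓝[≠] z] fun w => (w - z) ^ n := by
      intro m n hmn hO
      have hlt : (fun w : ℂ => (w - z) ^ n) =o[𝓝[≠] z] fun w => (w - z) ^ m :=
        Asymptotics.IsLittleO.mono (by
          have := Asymptotics.isLittleO_pow_sub_pow_sub z hmn
          simp only [← norm_pow] at this
          exact this.of_norm_norm) nhdsWithin_le_nhds
      refine Asymptotics.isLittleO_irrefl ?_ (hO.trans_isLittleO hlt)
      refine Eventually.frequently ?_
      filter_upwards [self_mem_nhdsWithin] with w hw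
      exact pow_ne_zero _ (sub_ne_zero.2 hw)
    rcases lt_trichotomy (analyticOrderNatAt f z) (analyticOrderNatAt g z') with hlt | heq | hlt
    · exact absurd h4.1 (key _ _ hlt)
    · exact heq
    · exact absurd h4.2 (key _ _ hlt)

theorem sphereMult_sphereInv {F : ℂ → OnePoint ℂ} {z : ℂ}
    (hz : F z = ((0 : ℂ) : OnePoint ℂ)) :
    sphereMult (fun w => sphereInv (F w)) z = sphereMult F z := by
  have h0 : F z ≠ OnePoint.infty := by simp [hz]
  simp [sphereMult, hz]

/-- `T` stands for a change of charts, possibly anti-holomorphic. Values other than `0` and `∞` are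
left out because absolute values do not control `F w - F z` there; poles reduce to zeros by
inversion. -/
theorem sphereMult_eq_of_normEq {F G : ℂ → OnePoint ℂ} {T : ℂ → ℂ} {z z' : ℂ}
    (hF : SphereHolomorphicAt F z) (hG : SphereHolomorphicAt G z')
    (hT : Tendsto T (𝓝 z) (𝓝 z')) (hTz : T z = z')
    (hT' : (fun w => T w - z') =Θ[𝓝 z] fun w => w - z)
    (h : ∀ᶠ w in 𝓝 z, SphereNormEq (F w) (G (T w)))
    (hz : F z = ((0 : ℂ) : OnePoint ℂ) ∨ F z = OnePoint.infty) :
    sphereMult F z = sphereMult G z' := by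
  have key : ∀ {F G : ℂ → OnePoint ℂ}, SphereHolomorphicAt F z → SphereHolomorphicAt G z' →
      (∀ᶠ w in 𝓝 z, SphereNormEq (F w) (G (T w))) → F z = ((0 : ℂ) : OnePoint ℂ) →
      G z' = ((0 : ℂ) : OnePoint ℂ) ∧ sphereMult F z = sphereMult G z' := by
    intro F G hF hG h hz
    have hz' : G z' = ((0 : ℂ) : OnePoint ℂ) := by
      rw [← hTz, ← h.self_of_nhds.eq_zero_iff, hz]
    refine ⟨hz', ?_⟩
    have h1 := hF.analyticAt_sphereCoord (by simp [hz])
    have h2 := hG.analyticAt_sphereCoord (by simp [hz'])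
    have := analyticOrderNatAt_eq_of_norm_eq h1 h2 hT hT' (h.mono fun w hw => hw.2.symm)
    simpa [sphereMult, hz, hz'] using this
  rcases hz with hz | hz
  · exact (key hF hG h hz).2
  · have h1 := key hF.sphereInv hG.sphereInv (h.mono fun w hw => hw.sphereInv) (by simp [hz])
    have h2 := sphereMult_sphereInv (F := fun w => sphereInv (F w)) (z := z) (by simp [hz])
    have h3 := sphereMult_sphereInv (F := fun w => sphereInv (G w)) (z := z') h1.1
    simp only [sphereInv_sphereInv] at h2 h3
    rw [h2, h3, h1.2]

open Classical in
/-- The order at `z` of a map to the sphere: its multiplicity at a zero, minus its multiplicity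
at a pole. -/
def sphereOrder (F : ℂ → OnePoint ℂ) (z : ℂ) : ℤ :=
  (if F z = ((0 : ℂ) : OnePoint ℂ) then (sphereMult F z : ℤ) else 0) -
    (if F z = OnePoint.infty then (sphereMult F z : ℤ) else 0)

theorem sphereOrder_sphereInv (F : ℂ → OnePoint ℂ) (z : ℂ) :
    sphereOrder (fun w => sphereInv (F w)) z = - sphereOrder F z := by
  by_cases h0 : F z = ((0 : ℂ) : OnePoint ℂ)
  · simp [sphereOrder, h0, sphereMult_sphereInv h0]
  · by_cases h1 : F z = OnePoint.infty
    · have h2 := sphereMult_sphereInv (F := fun w => sphereInv (F w)) (z := z) (by simp [h1])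
      simp only [sphereInv_sphereInv] at h2
      simp [sphereOrder, h1, h2]
    · simp [sphereOrder, h0, h1]

/-- Local vanishing is excluded because `sphereMult` would then take its default value `0`. -/
theorem SphereHolomorphicAt.sphereMult_pos {F : ℂ → OnePoint ℂ} {z : ℂ}
    (hF : SphereHolomorphicAt F z) (hz : F z = ((0 : ℂ) : OnePoint ℂ))
    (h : ¬ ∀ᶠ w in 𝓝 z, F w = ((0 : ℂ) : OnePoint ℂ)) : 0 < sphereMult F z := by
  have hi : F z ≠ OnePoint.infty := by simp [hz]
  have ha := hF.analyticAt_sphereCoord hi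
  have h1 : analyticOrderAt (fun w => sphereCoord (F w)) z ≠ 0 :=
    ha.analyticOrderAt_ne_zero.2 (by simp [hz])
  have h2 : analyticOrderAt (fun w => sphereCoord (F w)) z ≠ ⊤ := by
    rw [Ne, analyticOrderAt_eq_top]
    refine fun h' => h ?_
    filter_upwards [h', hF.eventually_ne_infty hi] with w hw hw'
    rw [← coe_sphereCoord hw', hw]
  have h3 : sphereMult F z = analyticOrderNatAt (fun w => sphereCoord (F w)) z := by
    simp [sphereMult, hz]
  rw [h3, Nat.pos_iff_ne_zero, analyticOrderNatAt]
  simp [h1, h2]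

theorem SphereHolomorphicAt.sphereOrder_pos {F : ℂ → OnePoint ℂ} {z : ℂ}
    (hF : SphereHolomorphicAt F z) (hz : F z = ((0 : ℂ) : OnePoint ℂ))
    (h : ¬ ∀ᶠ w in 𝓝 z, F w = ((0 : ℂ) : OnePoint ℂ)) : 0 < sphereOrder F z := by
  have := hF.sphereMult_pos hz h
  simpa [sphereOrder, hz] using this

/-- This and its analogue for poles recover the zero set and the pole set of a function from its
divisor. -/
theorem SphereHolomorphicAt.sphereOrder_pos_iff {F : ℂ → OnePoint ℂ} {z : ℂ}
    (hF : SphereHolomorphicAt F z) (h : ¬ ∀ᶠ w in 𝓝 z, F w = ((0 : ℂ) : OnePoint ℂ)) :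
    0 < sphereOrder F z ↔ F z = ((0 : ℂ) : OnePoint ℂ) := by
  refine ⟨fun h' => ?_, fun h' => hF.sphereOrder_pos h' h⟩
  by_contra hz
  simp only [sphereOrder, hz, if_false] at h'
  split_ifs at h' <;> omega

theorem SphereHolomorphicAt.sphereOrder_neg_iff {F : ℂ → OnePoint ℂ} {z : ℂ}
    (hF : SphereHolomorphicAt F z) (h : ¬ ∀ᶠ w in 𝓝 z, F w = OnePoint.infty) :
    sphereOrder F z < 0 ↔ F z = OnePoint.infty := by
  have := hF.sphereInv.sphereOrder_pos_iff (by simpa using h)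
  rw [sphereOrder_sphereInv] at this
  simpa using this

/-- The leading term of a holomorphic map to the sphere. -/
theorem SphereHolomorphicAt.exists_eventually_eq_zpow_mul {F : ℂ → OnePoint ℂ} {z : ℂ}
    (hF : SphereHolomorphicAt F z) (h0 : ¬ ∀ᶠ w in 𝓝 z, F w = ((0 : ℂ) : OnePoint ℂ))
    (h1 : ¬ ∀ᶠ w in 𝓝 z, F w = OnePoint.infty) :
    ∃ a : ℂ → ℂ, AnalyticAt ℂ a z ∧ a z ≠ 0 ∧
      ∀ᶠ w in 𝓝 z, (w = z → F z ≠ ((0 : ℂ) : OnePoint ℂ) ∧ F z ≠ OnePoint.infty) →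
        F w ≠ ((0 : ℂ) : OnePoint ℂ) ∧ F w ≠ OnePoint.infty ∧
          sphereCoord (F w) = (w - z) ^ sphereOrder F z * a w := by
  have key : ∀ {F : ℂ → OnePoint ℂ}, SphereHolomorphicAt F z →
      (¬ ∀ᶠ w in 𝓝 z, F w = ((0 : ℂ) : OnePoint ℂ)) → F z ≠ OnePoint.infty →
      ∃ a : ℂ → ℂ, AnalyticAt ℂ a z ∧ a z ≠ 0 ∧
      ∀ᶠ w in 𝓝 z, (w = z → F z ≠ ((0 : ℂ) : OnePoint ℂ) ∧ F z ≠ OnePoint.infty) →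
        F w ≠ ((0 : ℂ) : OnePoint ℂ) ∧ F w ≠ OnePoint.infty ∧
          sphereCoord (F w) = (w - z) ^ sphereOrder F z * a w := by
    intro F hF h hi
    have ha := hF.analyticAt_sphereCoord hi
    by_cases hz : F z = ((0 : ℂ) : OnePoint ℂ)
    · have h2 : analyticOrderAt (fun w => sphereCoord (F w)) z ≠ ⊤ := by
        rw [Ne, analyticOrderAt_eq_top]
        refine fun h' => h ?_
        filter_upwards [h', hF.eventually_ne_infty hi] with w hw hw'
        rw [← coe_sphereCoord hw', hw]
      obtain ⟨a, ha1, ha2, ha3⟩ := ha.analyticOrderAt_ne_top.1 h2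
      refine ⟨a, ha1, ha2, ?_⟩
      filter_upwards [ha3, ha1.continuousAt.eventually_ne ha2, hF.eventually_ne_infty hi]
        with w hw1 hw2 hw3 hwz
      -- The guard admits `w = z` only if `F z` is neither `0` nor `∞`; at a zero it forces `w ≠ z`.
      have hne : w ≠ z := fun h => (hwz h).1 hz
      have ho : sphereOrder F z = analyticOrderNatAt (fun w => sphereCoord (F w)) z := by
        simp [sphereOrder, sphereMult, hz]
      refine ⟨fun hw => ?_, hw3, ?_⟩
      · rw [hw, sphereCoord_coe, smul_eq_mul] at hw1
        exact mul_ne_zero (pow_ne_zero _ (sub_ne_zero.2 hne)) hw2 hw1.symm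
      · rw [ho, zpow_natCast, hw1, smul_eq_mul]
    · have hc : sphereCoord (F z) ≠ 0 := by
        intro hc
        rw [← coe_sphereCoord hi, hc] at hz
        exact hz rfl
      refine ⟨_, ha, hc, ?_⟩
      filter_upwards [hF.eventually_ne_infty hi, ha.continuousAt.eventually_ne hc] with w hw hw' _
      refine ⟨fun h => hw' (by rw [h]; rfl), hw, ?_⟩
      simp [sphereOrder, hz, hi]
  by_cases hi : F z = OnePoint.infty
  · obtain ⟨a, ha1, ha2, ha3⟩ := key hF.sphereInv (by simpa using h1) (by simp [hi])
    refine ⟨fun w => (a w)⁻¹, ha1.inv ha2, inv_ne_zero ha2, ?_⟩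
    filter_upwards [ha3] with w hw hwz
    simp only [ne_eq, sphereInv_eq_zero, sphereInv_eq_infty, sphereCoord_sphereInv,
      sphereOrder_sphereInv] at hw
    obtain ⟨h2, h3, h4⟩ := hw fun h => ⟨(hwz h).2, (hwz h).1⟩
    refine ⟨h3, h2, ?_⟩
    rw [inv_eq_iff_eq_inv, mul_inv, zpow_neg, inv_inv] at h4
    exact h4
  · exact key hF h0 hi

end Sphere

/-! ### The orientation cover: charts, involution, compactness and connectedness -/

section Cover

variable {Y : Type*} [TopologicalSpace Y] [ChartedSpace ℂ Y]

/-! ## Compatible charts -/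

theorem trans_mem_compatibleCharts {e : OpenPartialHomeomorph Y ℂ} (he : e ∈ compatibleCharts Y)
    {τ : OpenPartialHomeomorph ℂ ℂ} (hτ : τ ∈ dianalyticGroupoid) :
    e ≫ₕ τ ∈ compatibleCharts Y := by
  intro e' he'
  obtain ⟨h1, h2⟩ := he e' he'
  constructor
  · rw [OpenPartialHomeomorph.trans_symm_eq_symm_trans_symm, OpenPartialHomeomorph.trans_assoc]
    exact dianalyticGroupoid.trans (dianalyticGroupoid.symm hτ) h1
  · rw [← OpenPartialHomeomorph.trans_assoc]
    exact dianalyticGroupoid.trans h2 hτ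

instance : ClosedUnderRestriction dianalyticGroupoid where
  closedUnderRestriction := by
    rintro e ⟨h1, h2⟩ s hs
    refine ⟨fun z hz => h1 z ?_, fun z hz => h2 z ?_⟩
    · exact hz.1
    · exact hz.1

theorem DianalyticAt.continuousAt {f : ℂ → ℂ} {z : ℂ} (h : DianalyticAt f z) :
    ContinuousAt f z := by
  rcases h with h | h
  · exact h.continuousAt
  · simpa [Function.comp_def] using Complex.continuous_conj.continuousAt.comp h.continuousAt

theorem DianalyticAt.isBigO_sub {f : ℂ → ℂ} {z : ℂ} (h : DianalyticAt f z) :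
    (fun w => f w - f z) =O[𝓝 z] fun w => w - z := by
  rcases h with h | h
  · exact h.differentiableAt.isBigO_sub
  · refine Asymptotics.IsBigO.of_norm_left ?_
    have := h.differentiableAt.isBigO_sub.norm_left
    simpa [← map_sub] using this

/-- Transition maps are bi-Lipschitz to first order: a transition and its inverse are both
differentiable up to conjugation, and conjugation is an isometry. -/
theorem isTheta_transition {e e' : OpenPartialHomeomorph Y ℂ} (he : e ∈ compatibleCharts Y)
    (he' : e' ∈ compatibleCharts Y) {y : Y} (hy : y ∈ e.source) (hy' : y ∈ e'.source) :
    (fun z => e' (e.symm z) - e' y) =Θ[𝓝 (e y)] fun z => z - e y := by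
  have h1 := dianalyticAt_transition he he' hy hy'
  have h2 := dianalyticAt_transition he' he hy' hy
  constructor
  · simpa [e.left_inv hy] using h1.isBigO_sub
  · have h3 : Tendsto (fun z => e' (e.symm z)) (𝓝 (e y)) (𝓝 (e' y)) := by
      simpa [ContinuousAt, e.left_inv hy] using h1.continuousAt
    have h4 := h2.isBigO_sub.comp_tendsto h3
    simp only [Function.comp_def, e'.left_inv hy'] at h4
    refine EventuallyEq.trans_isBigO ?_ h4
    filter_upwards [eventually_symm_mem hy hy', e.open_target.mem_nhds (e.map_source hy)]
      with z hz hz'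
    rw [e'.left_inv hz, e.right_inv hz']

theorem tendsto_transition {e e' : OpenPartialHomeomorph Y ℂ} {y : Y} (hy : y ∈ e.source)
    (hy' : y ∈ e'.source) : Tendsto (fun z => e' (e.symm z)) (𝓝 (e y)) (𝓝 (e' y)) :=
  (e'.continuousAt hy').tendsto.comp (e.tendsto_symm hy)

theorem not_sameOrientationAt_conjChart {e : OpenPartialHomeomorph Y ℂ} {y : Y}
    (hy : y ∈ e.source) : ¬ SameOrientationAt e (conjChart e) y := by
  intro h
  refine not_analyticAt_conj (e y) (h.congr ?_)
  filter_upwards [e.open_target.mem_nhds (e.map_source hy)] with z hz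
  exact congrArg (starRingEnd ℂ) (e.right_inv hz)

/-- The two alternatives of `DianalyticAt` are definitionally the two orientations. -/
theorem sameOrientationAt_or_conjChart {e e' : OpenPartialHomeomorph Y ℂ}
    (he : e ∈ compatibleCharts Y) (he' : e' ∈ compatibleCharts Y) {y : Y} (hy : y ∈ e.source)
    (hy' : y ∈ e'.source) : SameOrientationAt e e' y ∨ SameOrientationAt e (conjChart e') y :=
  dianalyticAt_transition he he' hy hy'

theorem SameOrientationAt.eventually {e e' : OpenPartialHomeomorph Y ℂ} {y : Y}
    (hy : y ∈ e.source) (h : SameOrientationAt e e' y) :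
    ∀ᶠ y' in 𝓝 y, SameOrientationAt e e' y' :=
  (e.continuousAt hy).eventually (AnalyticAt.eventually_analyticAt h)

namespace OrientationCover

@[simp] theorem proj_involution (x : OrientationCover Y) : proj (involution x) = proj x := by
  obtain ⟨e, he, y, hy, rfl⟩ := exists_eq_mk x
  rfl

theorem involution_ne (x : OrientationCover Y) : involution x ≠ x := by
  obtain ⟨e, he, y, hy, rfl⟩ := exists_eq_mk x
  intro h
  exact not_sameOrientationAt_conjChart hy
    (mk_eq_mk.1 ((involution_mk e he y hy).symm.trans h).symm).2

theorem eq_or_eq_involution {x x' : OrientationCover Y} (h : proj x = proj x') :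
    x = x' ∨ x = involution x' := by
  obtain ⟨e, he, y, hy, rfl⟩ := exists_eq_mk x
  obtain ⟨e', he', y', hy', rfl⟩ := exists_eq_mk x'
  obtain rfl : y = y' := h
  exact (sameOrientationAt_or_conjChart he he' hy hy').imp (fun h => mk_eq_mk.2 ⟨rfl, h⟩)
    fun h => (involution_mk e' he' y hy').symm ▸ mk_eq_mk.2 ⟨rfl, h⟩

@[simp] theorem involution_involution (x : OrientationCover Y) :
    involution (involution x) = x := by
  rcases eq_or_eq_involution (x := involution (involution x)) (x' := x) (by simp) with h | h
  · exact h
  · exact absurd h (involution_ne _)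

theorem eventually_mk_eq_mk {e e' : OpenPartialHomeomorph Y ℂ} {he : e ∈ compatibleCharts Y}
    {he' : e' ∈ compatibleCharts Y} {y : Y} {hy : y ∈ e.source} {hy' : y ∈ e'.source}
    (h : mk e he y hy = mk e' he' y hy') :
    ∀ᶠ y' in 𝓝 y, ∀ (h : y' ∈ e.source) (h' : y' ∈ e'.source), mk e he y' h = mk e' he' y' h' := by
  filter_upwards [(mk_eq_mk.1 h).2.eventually hy] with y' hy' _ _
  exact mk_eq_mk.2 ⟨rfl, hy'⟩

variable [HasGroupoid Y dianalyticGroupoid]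

theorem proj_surjective : Function.Surjective (proj : OrientationCover Y → Y) :=
  fun y => ⟨basePoint y, rfl⟩

/-- The chart of `X` given by a compatible chart of `Y`, as a local homeomorphism. -/
def coverChart (e : OpenPartialHomeomorph Y ℂ) (he : e ∈ compatibleCharts Y) :
    OpenPartialHomeomorph (OrientationCover Y) ℂ :=
  (core Y).openPartialHomeomorph (liftChart e he) ⟨e, he, rfl⟩

theorem coverChart_mem_atlas (e : OpenPartialHomeomorph Y ℂ) (he : e ∈ compatibleCharts Y) :
    coverChart e he ∈ atlas ℂ (OrientationCover Y) := by
  refine mem_iUnion₂.2 ⟨liftChart e he, ⟨e, he, rfl⟩, rfl⟩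

theorem exists_eq_coverChart {c : OpenPartialHomeomorph (OrientationCover Y) ℂ}
    (hc : c ∈ atlas ℂ (OrientationCover Y)) : ∃ e he, c = coverChart e he := by
  obtain ⟨_, ⟨e, rfl⟩, _, ⟨⟨e, he, rfl⟩, rfl⟩, rfl⟩ := hc
  exact ⟨e, he, rfl⟩

@[simp] theorem coverChart_apply (e : OpenPartialHomeomorph Y ℂ) (he : e ∈ compatibleCharts Y)
    (x : OrientationCover Y) : coverChart e he x = e (proj x) := rfl

theorem mk_mem_coverChart_source (e : OpenPartialHomeomorph Y ℂ) (he : e ∈ compatibleCharts Y)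
    {y : Y} (hy : y ∈ e.source) : mk e he y hy ∈ (coverChart e he).source :=
  ⟨y, hy, rfl⟩

theorem coverChart_symm_apply (e : OpenPartialHomeomorph Y ℂ) (he : e ∈ compatibleCharts Y) {z : ℂ}
    (hz : z ∈ e.target) : (coverChart e he).symm z = mk e he (e.symm z) (e.map_target hz) :=
  liftChart_symm_apply e he hz

theorem coverChart_symm_eq_mk (e : OpenPartialHomeomorph Y ℂ) (he : e ∈ compatibleCharts Y) {y : Y}
    (hy : y ∈ e.source) : (coverChart e he).symm (e y) = mk e he y hy := by
  rw [coverChart_symm_apply e he (e.map_source hy)]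
  exact mk_eq_mk.2 ⟨e.left_inv hy, SameOrientationAt.refl (e.map_target (e.map_source hy))⟩

theorem exists_chartAt_eq (x : OrientationCover Y) : ∃ e he hy,
    chartAt ℂ x = coverChart e he ∧ x = mk e he (proj x) hy := by
  obtain ⟨e, he, h⟩ := exists_eq_coverChart (chart_mem_atlas ℂ x)
  obtain ⟨y, hy, h'⟩ : x ∈ (coverChart e he).source := h ▸ mem_chart_source ℂ x
  obtain rfl : proj x = y := by rw [h']; rfl
  exact ⟨e, he, hy, h, h'⟩

theorem continuousOn_section (e : OpenPartialHomeomorph Y ℂ) (he : e ∈ compatibleCharts Y) :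
    ContinuousOn (fun y => (coverChart e he).symm (e y)) e.source :=
  (coverChart e he).continuousOn_symm.comp e.continuousOn fun _ hy => e.map_source hy

/-- A chart `e` gives a continuous local section `y' ↦ mk e he y' _` of the covering, along which
neighbourhoods in `X` are pulled back to `Y`. -/
theorem eventually_mk {P : OrientationCover Y → Prop} {e : OpenPartialHomeomorph Y ℂ}
    {he : e ∈ compatibleCharts Y} {y : Y} {hy : y ∈ e.source} (h : ∀ᶠ x in 𝓝 (mk e he y hy), P x) :
    ∀ᶠ y' in 𝓝 y, ∀ hy', P (mk e he y' hy') := by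
  have h1 := (continuousOn_section e he).continuousAt (e.open_source.mem_nhds hy)
  rw [ContinuousAt, coverChart_symm_eq_mk e he hy] at h1
  filter_upwards [h1.eventually h] with y' hP hy'
  rwa [coverChart_symm_eq_mk e he hy'] at hP

theorem continuous_proj : Continuous (proj : OrientationCover Y → Y) := by
  rw [continuous_iff_continuousAt]
  intro x
  obtain ⟨e, he, y, hy, rfl⟩ := exists_eq_mk x
  have hs := mk_mem_coverChart_source e he hy
  have h1 : Tendsto (fun x => e.symm (coverChart e he x)) (𝓝 (mk e he y hy)) (𝓝 y) :=
    (e.tendsto_symm hy).comp ((coverChart e he).continuousAt hs).tendsto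
  refine h1.congr' ?_
  filter_upwards [(coverChart e he).open_source.mem_nhds hs] with x hx
  obtain ⟨y', hy', rfl⟩ := hx
  exact e.left_inv hy'

theorem isOpenMap_proj : IsOpenMap (proj : OrientationCover Y → Y) := by
  rw [isOpenMap_iff_nhds_le]
  intro x s hs
  obtain ⟨e, he, y, hy, rfl⟩ := exists_eq_mk x
  filter_upwards [eventually_mk (mem_map.1 hs), e.open_source.mem_nhds hy] with y' h h'
  exact h h'

/-- Over a small neighbourhood of `y` every point of `X` lies in one of two compact sets, the lifts
of a compact neighbourhood by `e` and by `conjChart e`; finitely many such neighbourhoods cover `Y`.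
-/
instance [CompactSpace Y] : CompactSpace (OrientationCover Y) := by
  have hK : ∀ y : Y, ∃ K : Set (OrientationCover Y), IsCompact K ∧
      ∀ᶠ y' in 𝓝 y, ∀ x, proj x = y' → x ∈ K := by
    intro y
    have : ∀ e : OpenPartialHomeomorph Y ℂ, ∀ he : e ∈ compatibleCharts Y, y ∈ e.source →
        ∃ K : Set (OrientationCover Y), IsCompact K ∧
          ∀ᶠ y' in 𝓝 y, ∀ x, proj x = y' → x ∈ (coverChart e he).source → x ∈ K := by
      intro e he hy
      obtain ⟨C, hC, hCe, hCc⟩ := local_compact_nhds (e.open_target.mem_nhds (e.map_source hy))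
      refine ⟨(coverChart e he).symm '' C,
        hCc.image_of_continuousOn ((coverChart e he).continuousOn_symm.mono hCe), ?_⟩
      filter_upwards [(e.continuousAt hy).eventually hC] with y' hy' x hx hxe
      refine ⟨e y', hy', ?_⟩
      rw [← hx, ← coverChart_apply e he, (coverChart e he).left_inv hxe]
    have he := dianalyticGroupoid.chart_mem_maximalAtlas y
    obtain ⟨K, hK, hK'⟩ := this _ he (mem_chart_source ℂ y)
    obtain ⟨L, hL, hL'⟩ := this _ (conjChart_mem he) (mem_conjChart_source (mem_chart_source ℂ y))
    refine ⟨K ∪ L, hK.union hL, ?_⟩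
    filter_upwards [hK', hL', chart_source_mem_nhds ℂ y] with y' h1 h2 h3 x hx
    rcases eq_or_eq_involution (x := x) (x' := mk _ he y' h3) hx with h | h
    · exact Or.inl (h1 x hx ⟨y', h3, h⟩)
    · exact Or.inr (h2 x hx ⟨y', h3, h⟩)
  choose K hK hK' using hK
  obtain ⟨t, ht⟩ := CompactSpace.elim_nhds_subcover _ hK'
  refine ⟨(t.isCompact_biUnion fun y _ => hK y).of_isClosed_subset isClosed_univ fun x _ => ?_⟩
  have hx : proj x ∈ (⊤ : Set Y) := trivial
  rw [← ht] at hx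
  obtain ⟨y, hy, h⟩ := mem_iUnion₂.1 hx
  exact mem_iUnion₂.2 ⟨y, hy, h x rfl⟩

theorem contDiffAt_of_dianalyticAt {f : ℂ → ℂ} {z : ℂ} (h : DianalyticAt f z) :
    ContDiffAt ℝ ∞ f z := by
  rcases h with h | h
  · exact (h.restrictScalars (𝕜 := ℝ)).contDiffAt
  · have h1 : ContDiffAt ℝ ∞ (fun w => starRingEnd ℂ (f w)) z :=
      (h.restrictScalars (𝕜 := ℝ)).contDiffAt
    have h2 := (Complex.conjCLE.contDiff (n := ∞)).contDiffAt.comp z h1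
    simpa [Function.comp_def] using h2

theorem mem_contDiffGroupoid_of_mem_dianalyticGroupoid {e : OpenPartialHomeomorph ℂ ℂ}
    (he : e ∈ dianalyticGroupoid) : e ∈ contDiffGroupoid ∞ 𝓘(ℝ, ℂ) := by
  rw [contDiffGroupoid, mem_groupoid_of_pregroupoid]
  refine ⟨fun z hz => ?_, fun z hz => ?_⟩
  · exact (contDiffAt_of_dianalyticAt (he.1 z hz.1)).contDiffWithinAt
  · exact (contDiffAt_of_dianalyticAt (he.2 z hz.1)).contDiffWithinAt

theorem compatibleCharts_subset_maximalAtlas :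
    compatibleCharts Y ⊆ IsManifold.maximalAtlas 𝓘(ℝ, ℂ) ∞ Y := by
  intro e he e' he'
  exact ⟨mem_contDiffGroupoid_of_mem_dianalyticGroupoid (he e' he').1,
    mem_contDiffGroupoid_of_mem_dianalyticGroupoid (he e' he').2⟩

/-- The real derivative of a holomorphic transition is multiplication by a complex number `c`, with
determinant `|c| ^ 2`. -/
theorem det_fderiv_pos {e e' : OpenPartialHomeomorph Y ℂ} (he : e ∈ compatibleCharts Y)
    (he' : e' ∈ compatibleCharts Y) {y : Y} (hy : y ∈ e.source) (hy' : y ∈ e'.source)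
    (h : SameOrientationAt e e' y) : 0 < (fderiv ℝ (e.symm ≫ₕ e') (e y)).det := by
  have ha : AnalyticAt ℂ (e.symm ≫ₕ e') (e y) := h
  have hd := ha.differentiableAt.hasDerivAt
  set c := deriv (e.symm ≫ₕ e') (e y)
  have hc : c ≠ 0 := by
    -- If `c = 0`, the transition is `o(z - e y)` after subtracting its value, against the lower
    -- bound in `isTheta_transition`.
    intro hc
    have h1 := hasDerivAt_iff_isLittleO.1 hd
    simp only [hc, smul_zero, sub_zero] at h1
    have h2 : (fun z => (e.symm ≫ₕ e') z - (e.symm ≫ₕ e') (e y)) =Θ[𝓝 (e y)] fun z => z - e y := by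
      simpa [e.left_inv hy] using isTheta_transition he he' hy hy'
    have h3 := (h2.2.trans_isLittleO h1).mono (nhdsWithin_le_nhds (s := {e y}ᶜ))
    refine Asymptotics.isLittleO_irrefl (Eventually.frequently ?_) h3
    filter_upwards [self_mem_nhdsWithin] with z hz using sub_ne_zero.2 hz
  have hf : fderiv ℝ (e.symm ≫ₕ e') (e y) = c • (1 : ℂ →L[ℝ] ℂ) := hd.complexToReal_fderiv.fderiv
  have hl : ((c • (1 : ℂ →L[ℝ] ℂ) : ℂ →L[ℝ] ℂ) : ℂ →ₗ[ℝ] ℂ) = Algebra.lmul ℝ ℂ c := by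
    ext
    all_goals simp
  rw [hf, ContinuousLinearMap.det, hl, ← Algebra.norm_apply, Algebra.norm_complex_apply]
  exact Complex.normSq_pos.2 hc

theorem isClopen_image_proj [T2Space Y] [CompactSpace Y] {A : Set (OrientationCover Y)}
    (hA : IsClopen A) : IsClopen (proj '' A) :=
  ⟨(hA.isClosed.isCompact.image continuous_proj).isClosed, isOpenMap_proj A hA.isOpen⟩

/-- Fibres have two points, so `A` and its complement meet each in exactly one: `A` is a continuous
choice of orientation, and the charts inducing it form an oriented atlas. -/
theorem orientable_of_isClopen {A : Set (OrientationCover Y)} (hA : IsClopen A)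
    (h : proj '' A = univ) (h' : proj '' Aᶜ = univ) : Orientable Y := by
  have hinv : ∀ x, x ∈ A ↔ involution x ∉ A := by
    intro x
    obtain ⟨a, ha, hax⟩ : proj x ∈ proj '' A := h ▸ mem_univ _
    obtain ⟨b, hb, hbx⟩ : proj x ∈ proj '' Aᶜ := h' ▸ mem_univ _
    rcases eq_or_eq_involution hax with rfl | rfl <;> rcases eq_or_eq_involution hbx with rfl | rfl
    · exact absurd ha hb
    · exact ⟨fun _ => hb, fun _ => ha⟩
    · exact ⟨fun h => absurd h hb, fun h => absurd ha h⟩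
    · exact absurd ha hb
  refine ⟨{e | ∃ he : e ∈ compatibleCharts Y, ∀ y hy, mk e he y hy ∈ A},
    fun e he => compatibleCharts_subset_maximalAtlas he.1, fun y => ?_, ?_⟩
  · obtain ⟨x, hx, rfl⟩ : y ∈ proj '' A := h ▸ mem_univ _
    obtain ⟨e, he, y, hy, rfl⟩ := exists_eq_mk x
    -- As `A` is open, the chart can be shrunk until all the orientations it induces lie in `A`.
    obtain ⟨s, hs, hso, hys⟩ := eventually_nhds_iff.1 (eventually_mk (hA.isOpen.mem_nhds hx))
    have hr := restr_mem_maximalAtlas dianalyticGroupoid he hso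
    refine ⟨e.restr s, ⟨hr, fun y' hy' => ?_⟩, hy, by rwa [hso.interior_eq]⟩
    have hy'' : y' ∈ s := by simpa [hso.interior_eq] using hy'.2
    have := hs y' hy'' hy'.1
    convert! this using 1
    exact mk_eq_mk.2 ⟨rfl, SameOrientationAt.refl hy'.1⟩
  · rintro e ⟨he, heA⟩ e' ⟨he', heA'⟩ z hz
    obtain ⟨hz, hz'⟩ := hz
    have hy : e.symm z ∈ e.source := e.map_target hz
    have hs : SameOrientationAt e e' (e.symm z) := by
      rcases sameOrientationAt_or_conjChart he he' hy hz' with hs | hs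
      · exact hs
      · exfalso
        have h1 : mk e he _ hy = involution (mk e' he' _ hz') := by
          rw [involution_mk]
          exact mk_eq_mk.2 ⟨rfl, hs⟩
        have h2 := heA _ hy
        rw [h1] at h2
        exact (hinv _).1 (heA' _ hz') h2
    have := det_fderiv_pos he he' hy hz' hs
    rwa [e.right_inv hz] at this

/-- If `A` is clopen and neither empty nor everything, `A` and its complement have nonempty clopen
images, which are all of the connected `Y`; then `A` orients `Y`. -/
theorem preconnectedSpace_of_not_orientable [T2Space Y] [CompactSpace Y] [ConnectedSpace Y]
    (hY : ¬ Orientable Y) : PreconnectedSpace (OrientationCover Y) := by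
  rw [preconnectedSpace_iff_clopen]
  intro A hA
  by_contra! hne
  have h1 := (isClopen_iff.1 (isClopen_image_proj hA)).resolve_left
    (by simpa using hne.1.ne_empty)
  have h2 := (isClopen_iff.1 (isClopen_image_proj hA.compl)).resolve_left
    (by simpa using hne.2)
  exact hY (orientable_of_isClopen hA h1 h2)

end OrientationCover

end Cover

/-! ### Half-plane charts, and comparison of divisors on `X` and on `Y` -/

section Divisors

variable {Y : Type*} [TopologicalSpace Y] [ChartedSpace ℂ Y]

/-! ## Charts with values in the upper half-plane -/

/-- The translation of the unit disc around `a` into the upper half-plane. -/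
def discTranslation (a : ℂ) : OpenPartialHomeomorph ℂ ℂ :=
  (Homeomorph.addRight ((1 - a.im : ℝ) * I)).toOpenPartialHomeomorph.restr (Metric.ball a 1)

theorem discTranslation_source (a : ℂ) : (discTranslation a).source = Metric.ball a 1 := by
  simp [discTranslation, Metric.isOpen_ball.interior_eq]

theorem discTranslation_apply (a z : ℂ) : discTranslation a z = z + (1 - a.im : ℝ) * I := rfl

theorem discTranslation_symm_apply (a z : ℂ) :
    (discTranslation a).symm z = z - (1 - a.im : ℝ) * I := by
  change z + -_ = _
  ring

theorem discTranslation_mem (a : ℂ) : discTranslation a ∈ dianalyticGroupoid := by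
  refine ⟨fun z _ => Or.inl ?_, fun z _ => Or.inl ?_⟩
  · exact analyticAt_id.add analyticAt_const
  · exact analyticAt_id.add analyticAt_const

/-- The centre is moved to imaginary part `1`, and the radius is `1`. -/
theorem discTranslation_target_subset (a : ℂ) :
    (discTranslation a).target ⊆ {z : ℂ | 0 < z.im} := by
  intro z hz
  have h1 := (discTranslation a).map_target hz
  rw [discTranslation_source, discTranslation_symm_apply, mem_ball_iff_norm] at h1
  have h2 := (abs_le.1 (Complex.abs_im_le_norm (z - (1 - a.im : ℝ) * I - a))).1
  simp at h2
  simp only [mem_ofPred_eq]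
  push_cast at h1
  linarith

/-- Reflection of the plane in the imaginary axis. -/
def imagReflection : ℂ ≃ₜ ℂ := Complex.conjCLE.toHomeomorph.trans (Homeomorph.neg ℂ)

theorem imagReflection_symm_apply (z : ℂ) : imagReflection.symm z = -(starRingEnd ℂ z) := by
  change starRingEnd ℂ (-z) = _
  simp

theorem dianalyticAt_neg_conj (z : ℂ) : DianalyticAt (fun w => -(starRingEnd ℂ w)) z := by
  refine Or.inr ?_
  exact analyticAt_id.neg.congr (Eventually.of_forall fun w => by simp)

theorem imagReflection_mem : imagReflection.toOpenPartialHomeomorph ∈ dianalyticGroupoid := by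
  refine ⟨fun z _ => dianalyticAt_neg_conj z, fun z _ => ?_⟩
  exact (dianalyticAt_neg_conj z).congr
    (Eventually.of_forall fun w => (imagReflection_symm_apply w).symm)

/-- The chart `e` followed by the reflection in the imaginary axis. -/
def reflectChart (e : OpenPartialHomeomorph Y ℂ) : OpenPartialHomeomorph Y ℂ :=
  e ≫ₕ imagReflection.toOpenPartialHomeomorph

theorem reflectChart_apply (e : OpenPartialHomeomorph Y ℂ) (y : Y) :
    reflectChart e y = -(starRingEnd ℂ (e y)) := rfl

@[simp] theorem reflectChart_source (e : OpenPartialHomeomorph Y ℂ) :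
    (reflectChart e).source = e.source := by
  simp [reflectChart]

theorem mem_reflectChart_target {e : OpenPartialHomeomorph Y ℂ} {z : ℂ} :
    z ∈ (reflectChart e).target ↔ -(starRingEnd ℂ z) ∈ e.target := by
  simp [reflectChart, imagReflection_symm_apply]

theorem reflectChart_mem_compatibleCharts {e : OpenPartialHomeomorph Y ℂ}
    (he : e ∈ compatibleCharts Y) : reflectChart e ∈ compatibleCharts Y :=
  trans_mem_compatibleCharts he imagReflection_mem

theorem reflectChart_mem {e : OpenPartialHomeomorph Y ℂ} (he : e ∈ halfPlaneCharts Y) :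
    reflectChart e ∈ halfPlaneCharts Y := by
  refine ⟨reflectChart_mem_compatibleCharts he.1, fun z hz => ?_⟩
  have := he.2 (mem_reflectChart_target.1 hz)
  simpa using this

namespace OrientationCover

/-- Unlike conjugation, the reflection in the imaginary axis preserves the upper half-plane, so `σ`
can be described by half-plane charts. The two reflections differ by the holomorphic map `z ↦ -z`.
-/
theorem involution_mk_eq_reflectChart (e : OpenPartialHomeomorph Y ℂ) (he : e ∈ compatibleCharts Y)
    (y : Y) (hy : y ∈ e.source) :
    involution (mk e he y hy) =
      mk (reflectChart e) (reflectChart_mem_compatibleCharts he) y (by simpa using hy) := by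
  rw [involution_mk]
  refine mk_eq_mk.2 ⟨rfl, analyticAt_id.neg.congr ?_⟩
  filter_upwards [(conjChart e).open_target.mem_nhds ((conjChart e).map_source hy)] with z hz
  have h := (conjChart e).right_inv hz
  exact congrArg Neg.neg h.symm

/-- Lifts of morphisms exist only on half-plane charts. Restricting a chart to a disc and
translating it is holomorphic, so the orientation is kept. -/
theorem exists_mem_halfPlaneCharts (x : OrientationCover Y) :
    ∃ e, ∃ he : e ∈ halfPlaneCharts Y, ∃ hx : proj x ∈ e.source, x = mk e he.1 (proj x) hx := by
  obtain ⟨e, he, y, hy, rfl⟩ := exists_eq_mk x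
  have hc := trans_mem_compatibleCharts he (discTranslation_mem (e y))
  have hs : y ∈ (e ≫ₕ discTranslation (e y)).source := by
    simp [discTranslation_source, hy]
  refine ⟨e ≫ₕ discTranslation (e y), ⟨hc, fun z hz => ?_⟩, hs, ?_⟩
  · rw [OpenPartialHomeomorph.trans_target] at hz
    exact discTranslation_target_subset _ hz.1
  · refine mk_eq_mk.2 ⟨rfl, (analyticAt_id.add (analyticAt_const
      (v := ((1 - (e y).im : ℝ) * I : ℂ)))).congr ?_⟩
    filter_upwards [e.open_target.mem_nhds (e.map_source hy)] with z hz
    simp [discTranslation_apply, e.right_inv hz]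

end OrientationCover

open OrientationCover

/-! ## Divisors on the double cover -/

section

variable {X : Type*} [TopologicalSpace X] [ChartedSpace ℂ X]

theorem divCoeff_eq_sphereOrder (f : X → OnePoint ℂ) (x : X) :
    divCoeff f x = sphereOrder (f ∘ (chartAt ℂ x).symm) (chartAt ℂ x x) := by
  have h : (f ∘ (chartAt ℂ x).symm) (chartAt ℂ x x) = f x :=
    congrArg f ((chartAt ℂ x).left_inv (mem_chart_source ℂ x))
  rw [divCoeff, sphereOrder, multAt, h]

end

theorem involution_bijective : Function.Bijective (involution : OrientationCover Y → _) :=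
  Function.Involutive.bijective involution_involution

theorem sphereMult_eq_of_charts {e e' : OpenPartialHomeomorph Y ℂ} (he : e ∈ compatibleCharts Y)
    (he' : e' ∈ compatibleCharts Y) {y : Y} (hy : y ∈ e.source) (hy' : y ∈ e'.source)
    {F G : ℂ → OnePoint ℂ} (hF : SphereHolomorphicAt F (e y)) (hG : SphereHolomorphicAt G (e' y))
    (h : ∀ᶠ y' in 𝓝 y, SphereNormEq (F (e y')) (G (e' y')))
    (h0 : F (e y) = ((0 : ℂ) : OnePoint ℂ) ∨ F (e y) = OnePoint.infty) :
    sphereMult F (e y) = sphereMult G (e' y) := by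
  refine sphereMult_eq_of_normEq hF hG (tendsto_transition hy hy') (by rw [e.left_inv hy])
    (isTheta_transition he he' hy hy') ?_ h0
  filter_upwards [(e.tendsto_symm hy).eventually h, e.open_target.mem_nhds (e.map_source hy)]
    with z h1 h2
  rwa [e.right_inv h2] at h1

theorem sphereOrder_eq_of_charts {e e' : OpenPartialHomeomorph Y ℂ} (he : e ∈ compatibleCharts Y)
    (he' : e' ∈ compatibleCharts Y) {y : Y} (hy : y ∈ e.source) (hy' : y ∈ e'.source)
    {F G : ℂ → OnePoint ℂ} (hF : SphereHolomorphicAt F (e y)) (hG : SphereHolomorphicAt G (e' y))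
    (h : ∀ᶠ y' in 𝓝 y, SphereNormEq (F (e y')) (G (e' y'))) :
    sphereOrder F (e y) = sphereOrder G (e' y) := by
  have h1 := sphereMult_eq_of_charts he he' hy hy' hF hG h
  have h2 := h.self_of_nhds
  by_cases h0 : F (e y) = ((0 : ℂ) : OnePoint ℂ)
  · simp [sphereOrder, h0, h2.eq_zero_iff.1 h0, h1 (Or.inl h0)]
  · have h0' : G (e' y) ≠ ((0 : ℂ) : OnePoint ℂ) := fun h => h0 (h2.eq_zero_iff.2 h)
    by_cases hi : F (e y) = OnePoint.infty
    · simp [sphereOrder, hi, h2.1.1 hi, h1 (Or.inr hi)]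
    · have hi' : G (e' y) ≠ OnePoint.infty := fun h => hi (h2.1.2 h)
      simp [sphereOrder, h0, hi, h0', hi']

variable [HasGroupoid Y dianalyticGroupoid]

/-- The fibre of `x` consists of the base point and its image under `σ`, so exactly one of the two
terms over `proj x` contributes at `x`. In particular the choice of base points is immaterial. -/
theorem Divisor.pullback_apply (D : Divisor Y) (x : OrientationCover Y) :
    D.pullback x = D (proj x) := by
  classical
  have h : ∀ (y : Y) (n : ℤ), (Finsupp.single (basePoint y) n +
      Finsupp.single (OrientationCover.involution (basePoint y)) n) x = if y = proj x then n else 0 := by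
    intro y n
    rw [Finsupp.add_apply, Finsupp.single_apply, Finsupp.single_apply]
    by_cases hy : y = proj x
    · subst hy
      have h1 : proj x = proj (basePoint (proj x)) := rfl
      rcases eq_or_eq_involution h1 with h | h
      · have h2 : basePoint (proj x) = x := h.symm
        simp [h2, involution_ne]
      · have h2 : basePoint (proj x) ≠ x := fun h' => involution_ne _ (h.symm.trans h'.symm)
        simp [h2, ← h]
    · have h1 : basePoint y ≠ x := by rintro rfl; exact hy rfl
      have h2 : OrientationCover.involution (basePoint y) ≠ x := by
        rintro rfl
        exact hy (proj_involution (basePoint y)).symm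
      simp [hy, h1, h2]
  rw [Divisor.pullback, Finsupp.sum_apply]
  refine (Finsupp.sum_congr (g2 := fun y n => if y = proj x then n else 0)
    fun y _ => h y (D y)).trans ?_
  simpa [Finsupp.sum_ite_eq'] using Eq.symm

theorem Divisor.involution_pullback (D : Divisor Y) : D.pullback.involution = D.pullback := by
  ext x
  obtain ⟨x, rfl⟩ := involution_bijective.2 x
  rw [Divisor.involution, Finsupp.mapDomain_apply involution_bijective.1, pullback_apply,
    pullback_apply, proj_involution]

theorem IsHolomorphicToSphere.coverChart {f : OrientationCover Y → OnePoint ℂ}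
    (hf : IsHolomorphicToSphere f) {e : OpenPartialHomeomorph Y ℂ} (he : e ∈ compatibleCharts Y)
    {z : ℂ} (hz : z ∈ e.target) : SphereHolomorphicAt (f ∘ (coverChart e he).symm) z :=
  hf _ (coverChart_mem_atlas e he) z hz

theorem isHolomorphicToSphere_iff {f : OrientationCover Y → OnePoint ℂ} :
    IsHolomorphicToSphere f ↔ ∀ e, ∀ he : e ∈ compatibleCharts Y, ∀ y ∈ e.source,
      SphereHolomorphicAt (f ∘ (OrientationCover.coverChart e he).symm) (e y) := by
  refine ⟨fun hf e he y hy => hf.coverChart he (e.map_source hy), fun h c hc z hz => ?_⟩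
  obtain ⟨e, he, rfl⟩ := exists_eq_coverChart hc
  have hz' : z ∈ e.target := hz
  have := h e he _ (e.map_target hz')
  rwa [e.right_inv hz'] at this

/-- The divisor, defined through `chartAt`, can be computed in any compatible chart. -/
theorem divCoeff_mk {f : OrientationCover Y → OnePoint ℂ} (hf : IsHolomorphicToSphere f)
    {e : OpenPartialHomeomorph Y ℂ} {he : e ∈ compatibleCharts Y} {y : Y} {hy : y ∈ e.source} :
    divCoeff f (mk e he y hy) = sphereOrder (f ∘ (coverChart e he).symm) (e y) := by
  obtain ⟨e', he', hy', h1, h2⟩ := exists_chartAt_eq (mk e he y hy)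
  rw [divCoeff_eq_sphereOrder, h1]
  refine sphereOrder_eq_of_charts he' he hy' hy (hf.coverChart he' (e'.map_source hy'))
    (hf.coverChart he (e.map_source hy)) ?_
  filter_upwards [eventually_mk_eq_mk h2, e.open_source.mem_nhds hy, e'.open_source.mem_nhds hy']
    with y' h3 h4 h5
  simp only [Function.comp_apply]
  rw [coverChart_symm_eq_mk _ _ h4, coverChart_symm_eq_mk _ _ h5, h3 h4 h5]
  exact ⟨Iff.rfl, rfl⟩

theorem divCoeff_eq_of_normEq {f g : OrientationCover Y → OnePoint ℂ}
    (hf : IsHolomorphicToSphere f) (hg : IsHolomorphicToSphere g)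
    (h : ∀ x, SphereNormEq (f x) (g x)) (x : OrientationCover Y) :
    divCoeff f x = divCoeff g x := by
  obtain ⟨e, he, y, hy, rfl⟩ := exists_eq_mk x
  rw [divCoeff_mk hf, divCoeff_mk hg]
  exact sphereOrder_eq_of_charts he he hy hy (hf.coverChart he (e.map_source hy))
    (hg.coverChart he (e.map_source hy)) (Eventually.of_forall fun _ => h _)

/-- The charts `e` at `x` and `conjChart e` at `σ x` are charts of `Y` at the same point, so this is
again invariance under a change of charts. -/
theorem divCoeff_eq_of_normEq_involution {f g : OrientationCover Y → OnePoint ℂ}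
    (hf : IsHolomorphicToSphere f) (hg : IsHolomorphicToSphere g)
    (h : ∀ x, SphereNormEq (f x) (g (involution x))) (x : OrientationCover Y) :
    divCoeff f x = divCoeff g (involution x) := by
  obtain ⟨e, he, y, hy, rfl⟩ := exists_eq_mk x
  rw [involution_mk, divCoeff_mk hf, divCoeff_mk hg]
  refine sphereOrder_eq_of_charts he (conjChart_mem he) hy hy
    (hf.coverChart he (e.map_source hy))
    (hg.coverChart (conjChart_mem he) ((conjChart e).map_source hy)) ?_
  filter_upwards [e.open_source.mem_nhds hy] with y' hy'
  simp only [Function.comp_apply]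
  rw [coverChart_symm_eq_mk _ _ hy',
    coverChart_symm_eq_mk (conjChart e) _ (mem_conjChart_source hy'), ← involution_mk]
  exact h _

/-- The divisor of a morphism to the closed half-plane pulls back to the divisor of any
meromorphic function lifting it to the double cover. -/
theorem divCoeff_eq_morphismDivCoeff {f : OrientationCover Y → OnePoint ℂ}
    (hf : IsHolomorphicToSphere f) {u : Y → ClosedHalfPlane} (hu : IsMorphism u)
    (h : ∀ x, u (proj x) = toHalfPlane (f x)) (x : OrientationCover Y) :
    divCoeff f x = morphismDivCoeff u (proj x) := by
  have key : (f x = ((0 : ℂ) : OnePoint ℂ) ∨ f x = OnePoint.infty) →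
      morphismMult u (proj x) = multAt f x := by
    intro h0
    -- All local lifts have the absolute value of `f`, so they give one multiplicity; a half-plane
    -- chart exists at the point, so the set is nonempty and `sInf` is not at its default value.
    have hset : {n | ∃ e ∈ halfPlaneCharts Y, proj x ∈ e.source ∧
        ∃ F, IsLocalLift u e F ∧ n = sphereMult F (e (proj x))} = {multAt f x} := by
      refine Set.eq_singleton_iff_nonempty_unique_mem.2 ⟨?_, ?_⟩
      · obtain ⟨e, he, hx, -⟩ := exists_mem_halfPlaneCharts x
        obtain ⟨F, hF⟩ := hu.exists_lift e he
        exact ⟨_, e, he, hx, F, hF, rfl⟩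
      · rintro n ⟨e, he, hx, F, hF, rfl⟩
        obtain ⟨e', he', hy', h1, h2⟩ := exists_chartAt_eq x
        rw [multAt, h1]
        refine (sphereMult_eq_of_charts he' he.1 hy' hx
          (hf.coverChart he' (e'.map_source hy')) (hF.holomorphic _ (e.map_source hx)) ?_ ?_).symm
        · filter_upwards [e.open_source.mem_nhds hx, e'.open_source.mem_nhds hy'] with y' h4 h5
          refine sphereNormEq_of_toHalfPlane_eq ?_
          simp only [Function.comp_apply]
          rw [coverChart_symm_eq_mk _ _ h5, ← hF.fold _ h4, ← h, proj_mk]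
        · simp only [Function.comp_apply]
          rwa [coverChart_symm_eq_mk _ _ hy', ← h2]
    rw [morphismMult, hset, csInf_singleton]
  have h0 : u (proj x) = toHalfPlane ((0 : ℂ) : OnePoint ℂ) ↔ f x = ((0 : ℂ) : OnePoint ℂ) := by
    rw [h, toHalfPlane_eq_zero]
  have hi : u (proj x) = toHalfPlane OnePoint.infty ↔ f x = OnePoint.infty := by
    rw [h, toHalfPlane_eq_infty]
  unfold divCoeff morphismDivCoeff fibreCoeff
  by_cases h1 : f x = ((0 : ℂ) : OnePoint ℂ)
  · have h2 : f x ≠ OnePoint.infty := by simp [h1]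
    rw [if_pos h1, if_neg h2, if_pos (h0.2 h1), if_neg (hi.not.2 h2), key (Or.inl h1)]
  · by_cases h2 : f x = OnePoint.infty
    · rw [if_neg h1, if_pos h2, if_neg (h0.not.2 h1), if_pos (hi.2 h2), key (Or.inr h2)]
    · rw [if_neg h1, if_neg h2, if_neg (h0.not.2 h1), if_neg (hi.not.2 h2)]

end Divisors

/-! ### From morphisms on `Y` to symmetric meromorphic functions on `X` -/

section Lifting

open OrientationCover

/-! ## The identity theorem -/

/-- The set of points near which `u = c` is open, and the hypothesis `h` makes it closed. -/
theorem eq_of_eventually_eq {Z β : Type*} [TopologicalSpace Z] [PreconnectedSpace Z] {u : Z → β}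
    {c : β} (h : ∀ y, (∃ᶠ y' in 𝓝[≠] y, u y' = c) → ∀ᶠ y' in 𝓝 y, u y' = c) {y₀ : Z}
    (h₀ : ∀ᶠ y in 𝓝 y₀, u y = c) (y : Z) : u y = c := by
  have hclosed : IsClosed {y | ∀ᶠ y' in 𝓝 y, u y' = c} := by
    rw [isClosed_iff_frequently]
    intro x hx
    by_contra hxS
    refine hxS (h x (frequently_nhdsWithin_iff.2 (hx.mono fun y hy => ⟨hy.self_of_nhds, ?_⟩)))
    rintro rfl
    exact hxS hy
  have huniv := IsClopen.eq_univ ⟨hclosed, isOpen_setOfPred_eventually_nhds⟩ ⟨y₀, h₀⟩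
  have hy : y ∈ {y | ∀ᶠ y' in 𝓝 y, u y' = c} := huniv ▸ mem_univ y
  exact Eventually.self_of_nhds (p := fun y => u y = c) hy

theorem tendsto_nhdsNE {Z : Type*} [TopologicalSpace Z] {e : OpenPartialHomeomorph Z ℂ} {y : Z}
    (hy : y ∈ e.source) : Tendsto e (𝓝[≠] y) (𝓝[≠] (e y)) := by
  refine tendsto_nhdsWithin_iff.2 ⟨(e.continuousAt hy).mono_left nhdsWithin_le_nhds, ?_⟩
  filter_upwards [self_mem_nhdsWithin, nhdsWithin_le_nhds (e.open_source.mem_nhds hy)] with y' h h'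
  exact fun heq => h (e.injOn h' hy heq)

section

variable {X : Type*} [TopologicalSpace X] [ChartedSpace ℂ X]

theorem IsHolomorphicToSphere.chartAt {f : X → OnePoint ℂ} (hf : IsHolomorphicToSphere f) (x : X) :
    SphereHolomorphicAt (f ∘ (chartAt ℂ x).symm) (chartAt ℂ x x) :=
  hf _ (chart_mem_atlas ℂ x) _ (mem_chart_target ℂ x)

theorem eventually_of_eventually_chartAt {f : X → OnePoint ℂ} {x : X} {p : OnePoint ℂ}
    (h : ∀ᶠ z in 𝓝 (chartAt ℂ x x), (f ∘ (chartAt ℂ x).symm) z = p) :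
    ∀ᶠ x' in 𝓝 x, f x' = p := by
  filter_upwards [((chartAt ℂ x).continuousAt (mem_chart_source ℂ x)).eventually h,
    chart_source_mem_nhds ℂ x] with x' h1 h2
  simpa [(chartAt ℂ x).left_inv h2] using h1

theorem IsHolomorphicToSphere.eq_of_eventually_eq [PreconnectedSpace X] {f : X → OnePoint ℂ}
    (hf : IsHolomorphicToSphere f) {p : OnePoint ℂ} {x₀ : X} (h₀ : ∀ᶠ x in 𝓝 x₀, f x = p) (x : X) :
    f x = p := by
  refine KleinSurface.eq_of_eventually_eq (fun x h => ?_) h₀ x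
  refine eventually_of_eventually_chartAt ((hf.chartAt x).eventually_eq_of_frequently
    ((tendsto_nhdsNE (mem_chart_source ℂ x)).frequently ?_))
  refine (h.and_eventually (nhdsWithin_le_nhds (chart_source_mem_nhds ℂ x))).mono fun x' hx' => ?_
  simpa [(_root_.chartAt ℂ x).left_inv hx'.2] using hx'.1

end

variable {Y : Type*} [TopologicalSpace Y] [ChartedSpace ℂ Y]

/-! ## Lifting morphisms to the double cover -/

theorem IsLocalLift.eventually_eq {u : Y → ClosedHalfPlane} {e : OpenPartialHomeomorph Y ℂ}
    {F : ℂ → OnePoint ℂ} (hF : IsLocalLift u e F) {y : Y} (hy : y ∈ e.source) {p : OnePoint ℂ}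
    (h : ∀ᶠ z in 𝓝 (e y), F z = p) : ∀ᶠ y' in 𝓝 y, u y' = toHalfPlane p := by
  filter_upwards [(e.continuousAt hy).eventually h, e.open_source.mem_nhds hy] with y' h1 h2
  rw [hF.fold y' h2, h1]

/-- `F` after a reflection is anti-holomorphic; applying `j` makes it holomorphic again without
changing its class in the half-plane. -/
theorem IsLocalLift.reflect {u : Y → ClosedHalfPlane} {e : OpenPartialHomeomorph Y ℂ}
    {F : ℂ → OnePoint ℂ} (hF : IsLocalLift u e F) :
    IsLocalLift u (reflectChart e) fun z => sphereConj (F (-(starRingEnd ℂ z))) where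
  holomorphic z hz := by
    have h1 := hF.holomorphic _ (mem_reflectChart_target.1 hz)
    have h2 := SphereHolomorphicAt.comp_analyticAt (F := F) (T := fun w => -w)
      (z := starRingEnd ℂ z) h1 analyticAt_id.neg
    exact h2.conj_conj
  fold y hy := by
    rw [toHalfPlane_sphereConj, reflectChart_apply, map_neg, neg_neg, Complex.conj_conj]
    exact hF.fold y (by simpa using hy)

variable [HasGroupoid Y dianalyticGroupoid]

theorem IsMorphism.eq_of_eventually_eq [PreconnectedSpace Y] {u : Y → ClosedHalfPlane}
    (hu : IsMorphism u) {c : ClosedHalfPlane} {y₀ : Y} (h₀ : ∀ᶠ y in 𝓝 y₀, u y = c) (y : Y) :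
    u y = c := by
  refine KleinSurface.eq_of_eventually_eq (fun y h => ?_) h₀ y
  obtain ⟨e, he, hy, -⟩ := exists_mem_halfPlaneCharts (basePoint y)
  obtain ⟨F, hF⟩ := hu.exists_lift e he
  obtain ⟨p, rfl⟩ := exists_toHalfPlane_eq c
  have hy' : y ∈ e.source := hy
  -- The value `c` has at most two preimages, `p` and `j p`; a lift takes one of them at points
  -- accumulating at `e y`.
  have h1 : ∃ᶠ z in 𝓝[≠] (e y), F z = p ∨ F z = sphereConj p := by
    refine (tendsto_nhdsNE hy').frequently ?_
    refine (h.and_eventually (nhdsWithin_le_nhds (e.open_source.mem_nhds hy'))).mono ?_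
    rintro y' ⟨h1, h2⟩
    rw [hF.fold y' h2, eq_comm, toHalfPlane_eq_iff] at h1
    exact h1
  have hFy := hF.holomorphic _ (e.map_source hy')
  rcases frequently_or_distrib.1 h1 with h2 | h2
  · exact hF.eventually_eq hy' (hFy.eventually_eq_of_frequently h2)
  · rw [← toHalfPlane_sphereConj]
    exact hF.eventually_eq hy' (hFy.eventually_eq_of_frequently h2)

/-- Local lifts of a nonconstant morphism in charts of the same orientation agree. -/
theorem IsMorphism.localLift_unique [PreconnectedSpace Y] {u : Y → ClosedHalfPlane}
    (hu : IsMorphism u) (hc : ∀ c, ∃ y, u y ≠ c) {e e' : OpenPartialHomeomorph Y ℂ} {y : Y}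
    (hy : y ∈ e.source) (hy' : y ∈ e'.source) (h : SameOrientationAt e e' y)
    {F F' : ℂ → OnePoint ℂ} (hF : IsLocalLift u e F) (hF' : IsLocalLift u e' F') :
    F (e y) = F' (e' y) := by
  have h1 := hF.holomorphic _ (e.map_source hy)
  have h2 : SphereHolomorphicAt (fun z => F' (e' (e.symm z))) (e y) :=
    SphereHolomorphicAt.comp_analyticAt (T := fun z => e' (e.symm z))
      (hF'.holomorphic _ (by simpa [e.left_inv hy] using e'.map_source hy')) h
  have h3 : ∀ᶠ z in 𝓝 (e y), toHalfPlane (F z) = toHalfPlane (F' (e' (e.symm z))) := by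
    filter_upwards [eventually_symm_mem hy hy', e.open_target.mem_nhds (e.map_source hy)]
      with z h4 h5
    rw [← hF'.fold _ h4, hF.fold _ (e.map_target h5), e.right_inv h5]
  rcases h1.eventually_eq_or_const h2 h3 with h4 | h4
  · have := h4.self_of_nhds
    simpa [e.left_inv hy] using this
  -- A locally constant lift would make `u` locally constant, hence constant.
  · obtain ⟨y', hy'⟩ := hc (toHalfPlane (F (e y)))
    exact absurd (hu.eq_of_eventually_eq (hF.eventually_eq hy h4) y') hy'

/-- The value of `f` at `x` is the common value of all local lifts in half-plane charts inducing the
orientation `x`. -/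
theorem IsMorphism.exists_lift_orientationCover [PreconnectedSpace Y] {u : Y → ClosedHalfPlane}
    (hu : IsMorphism u) (hc : ∀ c, ∃ y, u y ≠ c) :
    ∃ f : OrientationCover Y → OnePoint ℂ, IsHolomorphicToSphere f ∧
      (∀ x, u (proj x) = toHalfPlane (f x)) ∧ ∀ x, f (involution x) = sphereConj (f x) := by
  have hex : ∀ x : OrientationCover Y, ∃ v : OnePoint ℂ, ∀ e (he : e ∈ halfPlaneCharts Y)
      (hx : proj x ∈ e.source) F, x = OrientationCover.mk e he.1 (proj x) hx → IsLocalLift u e F →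
      F (e (proj x)) = v := by
    intro x
    obtain ⟨e, he, hx, h⟩ := exists_mem_halfPlaneCharts x
    obtain ⟨F, hF⟩ := hu.exists_lift e he
    refine ⟨F (e (proj x)), fun e' he' hx' F' h' hF' => ?_⟩
    exact hu.localLift_unique hc hx' hx (mk_eq_mk.1 (h'.symm.trans h)).2 hF' hF
  choose f hf using hex
  have hf' : ∀ {e} (he : e ∈ halfPlaneCharts Y) {y} (hy : y ∈ e.source) {F}, IsLocalLift u e F →
      f (OrientationCover.mk e he.1 y hy) = F (e y) := by
    intro e he y hy F hF
    exact (hf (OrientationCover.mk _ he.1 _ hy) _ he hy _ rfl hF).symm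
  refine ⟨f, isHolomorphicToSphere_iff.2 fun e he y hy => ?_, fun x => ?_, fun x => ?_⟩
  · obtain ⟨e', he', hy', h⟩ := exists_mem_halfPlaneCharts (OrientationCover.mk e he y hy)
    obtain ⟨F, hF⟩ := hu.exists_lift e' he'
    have hy'' : y ∈ e'.source := hy'
    have h1 : SphereHolomorphicAt (fun z => F (e' (e.symm z))) (e y) :=
      SphereHolomorphicAt.comp_analyticAt (T := fun z => e' (e.symm z))
        (hF.holomorphic _ (by simpa [e.left_inv hy] using e'.map_source hy''))
        (mk_eq_mk.1 h).2
    refine h1.congr ?_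
    have h2 : ∀ᶠ z in 𝓝 (e y), ∀ (h : e.symm z ∈ e.source) (h' : e.symm z ∈ e'.source),
        OrientationCover.mk e he _ h = OrientationCover.mk e' he'.1 _ h' :=
      (e.tendsto_symm hy).eventually (eventually_mk_eq_mk h)
    filter_upwards [h2, eventually_symm_mem hy hy'', e.open_target.mem_nhds (e.map_source hy)]
      with z h3 h4 h5
    rw [Function.comp_apply, coverChart_symm_apply e he h5, h3 (e.map_target h5) h4, hf' he' h4 hF]
  · obtain ⟨e, he, hx, h⟩ := exists_mem_halfPlaneCharts x
    obtain ⟨F, hF⟩ := hu.exists_lift e he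
    rw [hF.fold _ hx, hf x e he hx F h hF]
  · obtain ⟨e, he, hx, h⟩ := exists_mem_halfPlaneCharts x
    obtain ⟨F, hF⟩ := hu.exists_lift e he
    have h1 : f x = F (e (proj x)) := (hf x e he hx F h hF).symm
    rw [h1, h, involution_mk_eq_reflectChart e he.1]
    refine (hf' (reflectChart_mem he) (by simpa using hx) hF.reflect).trans ?_
    rw [reflectChart_apply, map_neg, neg_neg, Complex.conj_conj]
    rfl

theorem isHolomorphicToSphere_const {X : Type*} [TopologicalSpace X] [ChartedSpace ℂ X]
    (p : OnePoint ℂ) : IsHolomorphicToSphere (fun _ : X => p) :=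
  fun _ _ z _ => sphereHolomorphicAt_const p z

theorem IsKleinPrincipal.exists_symmetric [ConnectedSpace Y] {D : Divisor Y}
    (hD : IsKleinPrincipal D) :
    ∃ f : OrientationCover Y → OnePoint ℂ, IsNonzeroMeromorphic f ∧
      (∀ x, D.pullback x = divCoeff f x) ∧ ∀ x, f (involution x) = sphereConj (f x) := by
  obtain ⟨u, hu, ⟨y₀, h0⟩, ⟨y₁, h1⟩, hdiv⟩ := hD
  by_cases hc : ∀ c, ∃ y, u y ≠ c
  · obtain ⟨f, hf, hfu, hfσ⟩ := hu.exists_lift_orientationCover hc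
    refine ⟨f, ⟨hf, ⟨basePoint y₀, fun h => h0 ?_⟩, ⟨basePoint y₁, fun h => h1 ?_⟩⟩,
      fun x => ?_, hfσ⟩
    · rw [← h]
      exact hfu (basePoint y₀)
    · rw [← h]
      exact hfu (basePoint y₁)
    · rw [Divisor.pullback_apply, hdiv, divCoeff_eq_morphismDivCoeff hf hu hfu]
  -- A constant `u` need not have a symmetric lift, for instance at a non-real value. Its value is
  -- neither `0` nor `∞`, so `D = 0`, and the constant `1` has this divisor without lifting `u`.
  · push Not at hc
    obtain ⟨c, hc⟩ := hc
    rw [hc] at h0 h1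
    have hone : ((1 : ℂ) : OnePoint ℂ) ≠ ((0 : ℂ) : OnePoint ℂ) := by simp
    have hone' : ((1 : ℂ) : OnePoint ℂ) ≠ OnePoint.infty := by simp
    refine ⟨fun _ => ((1 : ℂ) : OnePoint ℂ), ⟨isHolomorphicToSphere_const _,
      ⟨basePoint y₀, hone⟩, ⟨basePoint y₀, hone'⟩⟩, fun x => ?_, fun x => by simp⟩
    rw [Divisor.pullback_apply, hdiv]
    simp [morphismDivCoeff, fibreCoeff, hc, h0, h1, divCoeff]

end Lifting

/-! ### From meromorphic functions on `X` with symmetric divisor to morphisms on `Y` -/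

section Symmetric

open OrientationCover

/-! ## Meromorphic functions with the same divisor -/

section

variable {X : Type*} [TopologicalSpace X] [ChartedSpace ℂ X] [PreconnectedSpace X]

theorem IsNonzeroMeromorphic.not_eventually_zero {f : X → OnePoint ℂ} (hf : IsNonzeroMeromorphic f)
    (x : X) : ¬ ∀ᶠ z in 𝓝 (chartAt ℂ x x),
      (f ∘ (chartAt ℂ x).symm) z = ((0 : ℂ) : OnePoint ℂ) := by
  intro h
  obtain ⟨x', hx'⟩ := hf.ne_zero
  exact hx' (hf.holomorphic.eq_of_eventually_eq (eventually_of_eventually_chartAt h) x')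

theorem IsNonzeroMeromorphic.not_eventually_infty {f : X → OnePoint ℂ}
    (hf : IsNonzeroMeromorphic f) (x : X) : ¬ ∀ᶠ z in 𝓝 (chartAt ℂ x x),
      (f ∘ (chartAt ℂ x).symm) z = OnePoint.infty := by
  intro h
  obtain ⟨x', hx'⟩ := hf.ne_infty
  exact hx' (hf.holomorphic.eq_of_eventually_eq (eventually_of_eventually_chartAt h) x')

theorem comp_chartAt_symm_apply (f : X → OnePoint ℂ) (x : X) :
    (f ∘ (chartAt ℂ x).symm) (chartAt ℂ x x) = f x :=
  congrArg f ((chartAt ℂ x).left_inv (mem_chart_source ℂ x))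

theorem IsNonzeroMeromorphic.divCoeff_pos_iff {f : X → OnePoint ℂ} (hf : IsNonzeroMeromorphic f)
    {x : X} : 0 < divCoeff f x ↔ f x = ((0 : ℂ) : OnePoint ℂ) := by
  rw [divCoeff_eq_sphereOrder,
    (hf.holomorphic.chartAt x).sphereOrder_pos_iff (hf.not_eventually_zero x),
    comp_chartAt_symm_apply]

theorem IsNonzeroMeromorphic.divCoeff_neg_iff {f : X → OnePoint ℂ} (hf : IsNonzeroMeromorphic f)
    {x : X} : divCoeff f x < 0 ↔ f x = OnePoint.infty := by
  rw [divCoeff_eq_sphereOrder,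
    (hf.holomorphic.chartAt x).sphereOrder_neg_iff (hf.not_eventually_infty x),
    comp_chartAt_symm_apply]

theorem IsNonzeroMeromorphic.exists_ne {f : X → OnePoint ℂ} (hf : IsNonzeroMeromorphic f) :
    ∃ x, f x ≠ ((0 : ℂ) : OnePoint ℂ) ∧ f x ≠ OnePoint.infty := by
  obtain ⟨x, -⟩ := hf.ne_zero
  obtain ⟨a, -, -, ha⟩ := (hf.holomorphic.chartAt x).exists_eventually_eq_zpow_mul
    (hf.not_eventually_zero x) (hf.not_eventually_infty x)
  obtain ⟨w, hw, hw'⟩ := ((ha.filter_mono nhdsWithin_le_nhds).and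
    (self_mem_nhdsWithin (a := chartAt ℂ x x) (s := {chartAt ℂ x x}ᶜ))).exists
  obtain ⟨h1, h2, -⟩ := hw fun h => absurd h hw'
  exact ⟨_, h1, h2⟩

/-- Equal orders give equal powers in the leading terms, which cancel: `g / f` is the quotient of
two nonvanishing holomorphic factors. At `x` itself the formula is claimed only if `f x` is neither
`0` nor `∞`. -/
theorem IsNonzeroMeromorphic.exists_eventually_div_eq {f g : X → OnePoint ℂ}
    (hf : IsNonzeroMeromorphic f) (hg : IsNonzeroMeromorphic g)
    (h : ∀ x, divCoeff f x = divCoeff g x) (x : X) :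
    ∃ q : ℂ → ℂ, AnalyticAt ℂ q (chartAt ℂ x x) ∧ ∀ᶠ x' in 𝓝 x,
      (x' = x → f x ≠ ((0 : ℂ) : OnePoint ℂ) ∧ f x ≠ OnePoint.infty) →
        (f x' ≠ ((0 : ℂ) : OnePoint ℂ) ∧ f x' ≠ OnePoint.infty) ∧
          sphereCoord (g x') / sphereCoord (f x') = q (chartAt ℂ x x') := by
  obtain ⟨a, ha, ha0, ha'⟩ := (hf.holomorphic.chartAt x).exists_eventually_eq_zpow_mul
    (hf.not_eventually_zero x) (hf.not_eventually_infty x)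
  obtain ⟨b, hb, hb0, hb'⟩ := (hg.holomorphic.chartAt x).exists_eventually_eq_zpow_mul
    (hg.not_eventually_zero x) (hg.not_eventually_infty x)
  rw [← divCoeff_eq_sphereOrder] at ha' hb'
  rw [← h] at hb'
  refine ⟨fun z => b z / a z, hb.div ha ha0, ?_⟩
  have hc := (chartAt ℂ x).continuousAt (mem_chart_source ℂ x)
  filter_upwards [hc.eventually ha', hc.eventually hb', chart_source_mem_nhds ℂ x,
    hc.eventually (ha.continuousAt.eventually_ne ha0)] with x' h1 h2 h3 h4 h5
  have h6 : chartAt ℂ x x' = chartAt ℂ x x → x' = x := fun h =>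
    (chartAt ℂ x).injOn h3 (mem_chart_source ℂ x) h
  simp only [Function.comp_apply, (chartAt ℂ x).left_inv h3,
    (chartAt ℂ x).left_inv (mem_chart_source ℂ x)] at h1 h2
  obtain ⟨h7, h8, h9⟩ := h1 fun h => h5 (h6 h)
  obtain ⟨-, -, h10⟩ := h2 fun h' => by
    have := h5 (h6 h')
    rw [Ne, Ne, ← hf.divCoeff_pos_iff, ← hf.divCoeff_neg_iff, h] at this
    rwa [Ne, Ne, ← hg.divCoeff_pos_iff, ← hg.divCoeff_neg_iff]
  refine ⟨⟨h7, h8⟩, ?_⟩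
  have h11 : sphereCoord (f x') ≠ 0 := fun h0 => h7 (by rw [← coe_sphereCoord h8, h0])
  rw [h9] at h11
  rw [h9, h10, mul_div_mul_left _ _ (left_ne_zero_of_mul h11)]

/-- On a compact connected Riemann surface, two meromorphic functions with the same divisor are
proportional. -/
theorem IsNonzeroMeromorphic.exists_sphereCoord_eq_mul [IsManifold 𝓘(ℂ) ω X] [CompactSpace X]
    {f g : X → OnePoint ℂ} (hf : IsNonzeroMeromorphic f) (hg : IsNonzeroMeromorphic g)
    (h : ∀ x, divCoeff f x = divCoeff g x) :
    ∃ c : ℂ, ∀ x, f x ≠ ((0 : ℂ) : OnePoint ℂ) → f x ≠ OnePoint.infty →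
      sphereCoord (g x) = c * sphereCoord (f x) := by
  choose q hq hq' using hf.exists_eventually_div_eq hg h
  -- `g / f` with its singularities removed: the value at `x` is that of the local quotient `q x`.
  -- Near `x` it coincides with `q x`, as both equal `g / f` off `x`.
  have hQ : MDifferentiable 𝓘(ℂ) 𝓘(ℂ) fun x => q x (chartAt ℂ x x) := by
    intro x
    have : IsManifold 𝓘(ℂ) 1 X := IsManifold.of_le (n := ω) le_top
    have h1 : MDifferentiableAt 𝓘(ℂ) 𝓘(ℂ) (fun x' => q x (chartAt ℂ x x')) x :=
      ((hq x).differentiableAt.mdifferentiableAt).comp x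
        (mdifferentiableAt_atlas (chart_mem_atlas ℂ x) (mem_chart_source ℂ x))
    refine h1.congr_of_eventuallyEq ?_
    filter_upwards [hq' x] with x' hx'
    rcases eq_or_ne x' x with rfl | hne
    · rfl
    · obtain ⟨h2, h3⟩ := hx' fun h => absurd h hne
      exact ((hq' x').self_of_nhds fun _ => h2).2.symm.trans h3
  obtain ⟨c, hc⟩ := hQ.exists_eq_const_of_compactSpace
  refine ⟨c, fun x h0 hi => ?_⟩
  have h1 := ((hq' x).self_of_nhds fun _ => ⟨h0, hi⟩).2
  have h2 : q x (chartAt ℂ x x) = c := congrFun hc x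
  have h3 : sphereCoord (f x) ≠ 0 := fun h => h0 (by rw [← coe_sphereCoord hi, h])
  rwa [h2, div_eq_iff h3] at h1

end

/-! ## Symmetric meromorphic functions -/

/-- Multiplication by `c` on the Riemann sphere. -/
def sphereScale (c : ℂ) : OnePoint ℂ → OnePoint ℂ := OnePoint.map (c * ·)

@[simp] theorem sphereScale_infty (c : ℂ) : sphereScale c OnePoint.infty = OnePoint.infty := rfl

@[simp] theorem sphereScale_coe (c z : ℂ) :
    sphereScale c (z : OnePoint ℂ) = ((c * z : ℂ) : OnePoint ℂ) := rfl

theorem sphereInv_sphereScale {c : ℂ} (hc : c ≠ 0) (p : OnePoint ℂ) :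
    sphereInv (sphereScale c p) = sphereScale c⁻¹ (sphereInv p) := by
  induction p using OnePoint.rec with
  | infty => simp
  | coe z =>
    rcases eq_or_ne z 0 with rfl | hz
    · simp
    · rw [sphereScale_coe, sphereInv_coe hz, sphereInv_coe (mul_ne_zero hc hz), sphereScale_coe,
        mul_inv]

/-- Unimodular factors suffice for the normalization, and then the divisor is unchanged because
absolute values are. -/
theorem sphereNormEq_sphereScale {c : ℂ} (hc : ‖c‖ = 1) (p : OnePoint ℂ) :
    SphereNormEq (sphereScale c p) p := by
  induction p using OnePoint.rec with
  | infty => simp [SphereNormEq]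
  | coe z => simp [SphereNormEq, hc]

theorem SphereHolomorphicAt.sphereScale {F : ℂ → OnePoint ℂ} {z c : ℂ} (hc : c ≠ 0)
    (hF : SphereHolomorphicAt F z) : SphereHolomorphicAt (fun w => sphereScale c (F w)) z := by
  obtain ⟨g, hg, h | h⟩ := hF
  · refine ⟨fun w => c * g w, analyticAt_const.mul hg, Or.inl ?_⟩
    filter_upwards [h] with w hw
    rw [hw, sphereScale_coe]
  · refine ⟨fun w => c⁻¹ * g w, analyticAt_const.mul hg, Or.inr ?_⟩
    filter_upwards [h] with w hw
    rw [sphereInv_sphereScale hc, hw, sphereScale_coe]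

theorem IsNonzeroMeromorphic.sphereScale {X : Type*} [TopologicalSpace X] [ChartedSpace ℂ X]
    {f : X → OnePoint ℂ} (hf : IsNonzeroMeromorphic f) {c : ℂ} (hc : ‖c‖ = 1) :
    IsNonzeroMeromorphic fun x => sphereScale c (f x) where
  holomorphic e he z hz :=
    SphereHolomorphicAt.sphereScale (by rintro rfl; simp at hc) (hf.holomorphic e he z hz)
  ne_zero := hf.ne_zero.imp fun x hx h => hx ((sphereNormEq_sphereScale hc _).eq_zero_iff.1 h)
  ne_infty := hf.ne_infty.imp fun x hx h => hx ((sphereNormEq_sphereScale hc _).1.1 h)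

variable {Y : Type*} [TopologicalSpace Y] [ChartedSpace ℂ Y] [HasGroupoid Y dianalyticGroupoid]

theorem sphereNormEq_sphereConj (p : OnePoint ℂ) : SphereNormEq (sphereConj p) p :=
  sphereNormEq_of_toHalfPlane_eq (toHalfPlane_sphereConj p)

/-- In the charts `e` and `conjChart e` the involution is complex conjugation, so the function is
locally of the form `z ↦ sphereConj (F (conj z))`. -/
theorem IsHolomorphicToSphere.conj_involution {f : OrientationCover Y → OnePoint ℂ}
    (hf : IsHolomorphicToSphere f) :
    IsHolomorphicToSphere fun x => sphereConj (f (involution x)) := by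
  refine isHolomorphicToSphere_iff.2 fun e he y hy => ?_
  have h1 : SphereHolomorphicAt
      (f ∘ (OrientationCover.coverChart (conjChart e) (conjChart_mem he)).symm)
      (starRingEnd ℂ (e y)) :=
    hf.coverChart (conjChart_mem he) ((conjChart e).map_source hy)
  refine h1.conj_conj.congr ?_
  filter_upwards [e.open_target.mem_nhds (e.map_source hy)] with z hz
  have h2 := e.map_target hz
  have h3 := coverChart_symm_eq_mk (conjChart e) (conjChart_mem he) (mem_conjChart_source h2)
  have h4 : conjChart e (e.symm z) = starRingEnd ℂ z := congrArg (starRingEnd ℂ) (e.right_inv hz)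
  rw [h4] at h3
  simp only [Function.comp_apply]
  rw [h3, coverChart_symm_apply e he hz, involution_mk]

theorem IsNonzeroMeromorphic.conj_involution {f : OrientationCover Y → OnePoint ℂ}
    (hf : IsNonzeroMeromorphic f) :
    IsNonzeroMeromorphic fun x => sphereConj (f (involution x)) where
  holomorphic := hf.holomorphic.conj_involution
  ne_zero := by
    obtain ⟨x, hx⟩ := hf.ne_zero
    refine ⟨involution x, fun h => hx ?_⟩
    rwa [involution_involution, (sphereNormEq_sphereConj _).eq_zero_iff] at h
  ne_infty := by
    obtain ⟨x, hx⟩ := hf.ne_infty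
    refine ⟨involution x, fun h => hx ?_⟩
    rwa [involution_involution, (sphereNormEq_sphereConj _).1] at h

/-- A meromorphic function with a symmetric divisor can be normalized to be symmetric. -/
theorem IsNonzeroMeromorphic.exists_symmetric [CompactSpace Y]
    [PreconnectedSpace (OrientationCover Y)]
    {f : OrientationCover Y → OnePoint ℂ} (hf : IsNonzeroMeromorphic f)
    (h : ∀ x, divCoeff f (involution x) = divCoeff f x) :
    ∃ g : OrientationCover Y → OnePoint ℂ, IsNonzeroMeromorphic g ∧
      (∀ x, divCoeff g x = divCoeff f x) ∧ ∀ x, g (involution x) = sphereConj (g x) := by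
  have hcd : ∀ x, divCoeff f x = divCoeff (fun x => sphereConj (f (involution x))) x := fun x => by
    rw [divCoeff_eq_of_normEq_involution hf.conj_involution.holomorphic hf.holomorphic
      (fun x => sphereNormEq_sphereConj _) x, h]
  obtain ⟨c, hc⟩ := hf.exists_sphereCoord_eq_mul hf.conj_involution hcd
  have hzero : ∀ x, f (involution x) = ((0 : ℂ) : OnePoint ℂ) ↔ f x = ((0 : ℂ) : OnePoint ℂ) :=
    fun x => by rw [← hf.divCoeff_pos_iff, h, hf.divCoeff_pos_iff]
  have hinf : ∀ x, f (involution x) = OnePoint.infty ↔ f x = OnePoint.infty :=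
    fun x => by rw [← hf.divCoeff_neg_iff, h, hf.divCoeff_neg_iff]
  have hfc : ∀ x (a b : ℂ), f x = (a : OnePoint ℂ) → f (involution x) = (b : OnePoint ℂ) →
      a ≠ 0 → starRingEnd ℂ b = c * a := by
    intro x a b ha hb ha0
    have := hc x (by simpa [ha] using ha0) (by simp [ha])
    simpa [ha, hb] using this
  -- At a point that is neither a zero nor a pole, the relation at `x` and at `σ x` gives `‖b‖ = ‖c‖
  -- * ‖a‖` and `‖a‖ = ‖c‖ * ‖b‖`.
  have hnorm : ‖c‖ = 1 := by
    obtain ⟨x, h0, hi⟩ := hf.exists_ne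
    obtain ⟨a, ha⟩ := OnePoint.ne_infty_iff_exists.1 hi
    obtain ⟨b, hb⟩ := OnePoint.ne_infty_iff_exists.1 (mt (hinf x).1 hi)
    have ha0 : a ≠ 0 := fun h => h0 (by rw [← ha, h])
    have hb0 : b ≠ 0 := fun h => h0 ((hzero x).1 (by rw [← hb, h]))
    have h1 := congrArg norm (hfc x a b ha.symm hb.symm ha0)
    have h2 := congrArg norm (hfc (involution x) b a hb.symm (by rw [involution_involution, ha]) hb0)
    rw [RCLike.norm_conj, norm_mul] at h1 h2
    have h3 : 0 < ‖a‖ := norm_pos_iff.2 ha0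
    have h4 : (‖c‖ * ‖c‖ - 1) * ‖a‖ = 0 := by rw [h1] at h2; linarith
    have h5 := (mul_eq_zero.1 h4).resolve_right h3.ne'
    nlinarith [norm_nonneg c]
  -- For unimodular `l`, the function `l f` is symmetric when `conj l * c = l`, that is, when `l ^ 2
  -- = c`.
  obtain ⟨l, hl⟩ := IsAlgClosed.exists_pow_nat_eq c (n := 2) two_pos
  have hl1 : ‖l‖ = 1 := by
    have : ‖l‖ ^ 2 = 1 := by rw [← norm_pow, hl, hnorm]
    nlinarith [norm_nonneg l]
  refine ⟨fun x => KleinSurface.sphereScale l (f x), hf.sphereScale hl1, fun x => ?_, fun x => ?_⟩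
  · exact divCoeff_eq_of_normEq (hf.sphereScale hl1).holomorphic hf.holomorphic
      (fun x => sphereNormEq_sphereScale hl1 _) x
  · by_cases hi : f x = OnePoint.infty
    · simp [hi, (hinf x).2 hi]
    · by_cases h0 : f x = ((0 : ℂ) : OnePoint ℂ)
      · simp [h0, (hzero x).2 h0]
      · obtain ⟨a, ha⟩ := OnePoint.ne_infty_iff_exists.1 hi
        obtain ⟨b, hb⟩ := OnePoint.ne_infty_iff_exists.1 (mt (hinf x).1 hi)
        have ha0 : a ≠ 0 := fun h => h0 (by rw [← ha, h])
        have h1 := congrArg (starRingEnd ℂ) (hfc x a b ha.symm hb.symm ha0)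
        rw [Complex.conj_conj, ← hl, map_mul, map_pow] at h1
        have h2 : l * starRingEnd ℂ l = 1 := by
          rw [Complex.mul_conj, Complex.normSq_eq_norm_sq, hl1]
          simp
        beta_reduce
        rw [← ha, ← hb, sphereScale_coe, sphereScale_coe, sphereConj_coe, h1, map_mul]
        congr 1
        linear_combination (starRingEnd ℂ l * starRingEnd ℂ a) * h2

/-! ## Morphisms from symmetric meromorphic functions -/

theorem isMorphism_of_lift {f : OrientationCover Y → OnePoint ℂ} (hf : IsHolomorphicToSphere f)
    {u : Y → ClosedHalfPlane} (h : ∀ x, u (proj x) = toHalfPlane (f x)) : IsMorphism u := by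
  have hlift : ∀ e (he : e ∈ compatibleCharts Y),
      IsLocalLift u e (f ∘ (OrientationCover.coverChart e he).symm) := by
    refine fun e he => ⟨fun z hz => hf.coverChart he hz, fun y hy => ?_⟩
    rw [Function.comp_apply, coverChart_symm_eq_mk e he hy, ← h, proj_mk]
  refine ⟨continuous_iff_continuousAt.2 fun y => ?_, fun e he => ⟨_, hlift e he.1⟩⟩
  have he := dianalyticGroupoid.chart_mem_maximalAtlas y
  have hy := mem_chart_source ℂ y
  have hF := hlift _ he
  have h1 : ContinuousAt (fun y' => toHalfPlane
      ((f ∘ (OrientationCover.coverChart _ he).symm) (chartAt ℂ y y'))) y :=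
    (continuous_quot_mk.continuousAt).comp
      (ContinuousAt.comp (g := f ∘ (OrientationCover.coverChart _ he).symm)
        (hF.holomorphic _ ((chartAt ℂ y).map_source hy)).continuousAt
        ((chartAt ℂ y).continuousAt hy))
  refine h1.congr ?_
  filter_upwards [chart_source_mem_nhds ℂ y] with y' hy'
  exact (hF.fold y' hy').symm

/-- Symmetry makes `p ∘ f` constant on the fibres of `π`, so evaluating at base points defines a
morphism lifted by `f`. -/
theorem isKleinPrincipal_of_symmetric {f : OrientationCover Y → OnePoint ℂ}
    (hf : IsNonzeroMeromorphic f) (hσ : ∀ x, f (involution x) = sphereConj (f x)) {D : Divisor Y}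
    (hD : ∀ x, D.pullback x = divCoeff f x) : IsKleinPrincipal D := by
  have hu : ∀ x, toHalfPlane (f (basePoint (proj x))) = toHalfPlane (f x) := by
    intro x
    have h1 : proj (basePoint (proj x)) = proj x := rfl
    rcases eq_or_eq_involution h1 with h | h
    · rw [h]
    · rw [h, hσ, toHalfPlane_sphereConj]
  have hm := isMorphism_of_lift (u := fun y => toHalfPlane (f (basePoint y))) hf.holomorphic hu
  refine ⟨_, hm, ?_, ?_, fun y => ?_⟩
  · obtain ⟨x, hx⟩ := hf.ne_zero
    refine ⟨proj x, ?_⟩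
    rwa [hu, Ne, toHalfPlane_eq_zero]
  · obtain ⟨x, hx⟩ := hf.ne_infty
    refine ⟨proj x, ?_⟩
    rwa [hu, Ne, toHalfPlane_eq_infty]
  · obtain ⟨x, rfl⟩ := proj_surjective y
    rw [← divCoeff_eq_morphismDivCoeff hf.holomorphic hm hu, ← hD, Divisor.pullback_apply]

theorem isKleinPrincipal_iff [T2Space Y] [CompactSpace Y] [ConnectedSpace Y] (hY : ¬ Orientable Y)
    (D : Divisor Y) : IsKleinPrincipal D ↔ IsPrincipal D.pullback := by
  constructor
  · intro hD
    obtain ⟨f, hf, hD, -⟩ := hD.exists_symmetric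
    exact ⟨f, hf, hD⟩
  · rintro ⟨f, hf, hD⟩
    have := preconnectedSpace_of_not_orientable hY
    obtain ⟨g, hg, hgf, hgσ⟩ := hf.exists_symmetric fun x => by
      rw [← hD, ← hD, Divisor.pullback_apply, Divisor.pullback_apply, proj_involution]
    exact isKleinPrincipal_of_symmetric hg hgσ fun x => by rw [hD, hgf]

end Symmetric

end KleinSurface

end

theorem mainTheorem5 {Y : Type*} [TopologicalSpace Y] [T2Space Y] [CompactSpace Y]
    [ConnectedSpace Y] [ChartedSpace ℂ Y] [HasGroupoid Y KleinSurface.dianalyticGroupoid]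
    (hY : ¬ KleinSurface.Orientable Y) :
    (∀ D : KleinSurface.Divisor Y,
      KleinSurface.IsKleinPrincipal D ↔
        ∃ E : KleinSurface.Divisor (KleinSurface.OrientationCover Y),
          KleinSurface.IsPrincipal E ∧ E.involution = E ∧ D.pullback = E) ∧
    (∀ D : KleinSurface.Divisor Y,
      KleinSurface.IsKleinPrincipal D ↔ KleinSurface.IsPrincipal D.pullback) ∧
    (∀ D : KleinSurface.Divisor Y, KleinSurface.IsKleinPrincipal D →
      ∃ f : KleinSurface.OrientationCover Y → OnePoint ℂ,
        KleinSurface.IsNonzeroMeromorphic f ∧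
        (∀ x, D.pullback x = KleinSurface.divCoeff f x) ∧
        ∀ x, f x.involution = KleinSurface.sphereConj (f x)) ∧
    (∀ D : KleinSurface.Divisor Y, D.degree = 0 →
      (KleinSurface.IsKleinPrincipal D ↔ KleinSurface.IsPrincipal D.pullback)) := by
  refine ⟨fun D => ?_, fun D => KleinSurface.isKleinPrincipal_iff hY D,
    fun D hD => hD.exists_symmetric, fun D _ => KleinSurface.isKleinPrincipal_iff hY D⟩
  rw [KleinSurface.isKleinPrincipal_iff hY]
  constructor
  -- Every pullback is `σ`-invariant, so the symmetry condition on `E` costs nothing.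
  · exact fun h => ⟨_, h, D.involution_pullback, rfl⟩
  · rintro ⟨E, hE, -, rfl⟩
    exact hE
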